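/- Let $\mathbf{k}$ be a field of characteristic zero. For $n\ge 0$ let $\mathfrak{lie}_n=\prod_{m\ge 1}\mathfrak{lie}^m(x_1,\dots,x_n)$ be the degree completion of the free Lie algebra over $\mathbf{k}$ on $x_1,\dots,x_n$ (for $n\le 3$ the generators are written $x,y,z$), and let $\mathfrak{tder}_n$ be the space of tangential derivations of $\mathfrak{lie}_n$, i.e. of the derivations $u$ for which there are $a_1,\dots,a_n\in\mathfrak{lie}_n$ with $u(x_i)=[x_i,a_i]$ for all $i$. The $a_i$ are unique if one requires that the coefficient of $x_i$ in the linear part of $a_i$ vanishes for every $i$; with this normalization one writes $u=(a_1,\dots,a_n)$. For $u=(a_1,\dots,a_n)\in\mathfrak{tder}_n$ define the following elements of $\mathfrak{tder}_{n+1}$: $$u^{2,3,\dots,n+1}=(0,a_1(x_2,\dots,x_{n+1}),\dots,a_n(x_2,\dots,x_{n+1})),\qquad u^{1,2,\dots,n}=(a_1,\dots,a_n,0),$$ and, for $1\le i\le n$, $u^{1,\dots,i(i+1),\dots,n+1}=(\tilde a_1,\dots,\tilde a_i,\tilde a_i,\tilde a_{i+1},\dots,\tilde a_n)$, where $\tilde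 a_j=a_j(x_1,\dots,x_{i-1},x_i+x_{i+1},x_{i+2},\dots,x_{n+1})$. Let $d:\mathfrak{tder}_n\to\mathfrak{tder}_{n+1}$ be the differential $$d u=u^{2,3,\dots,n+1}+\sum_{i=1}^{n}(-1)^i\,u^{1,\dots,i(i+1),\dots,n+1}+(-1)^{n+1}u^{1,2,\dots,n},$$ which satisfies $d^2=0$, and let $H^n(\mathfrak{tder},d)=\ker(d:\mathfrak{tder}_n\to\mathfrak{tder}_{n+1})/\operatorname{im}(d:\mathfrak{tder}_{n-1}\to\mathfrak{tder}_n)$. Then: 1. $H^2(\mathfrak{tder},d)=\ker(d:\mathfrak{tder}_2\to\mathfrak{tder}_3)$ (that is, the projection of the kernel onto $H^2$ is bijective), and this space is $\mathbf{k}\,r\oplus\mathbf{k}\,t$, where $r=(y,0)$ and $t=(y,x)$ are linearly independent. 2. $H^3(\mathfrak{tder},d)$ is one-dimensional: $(0,[z,x],0)\in\mathfrak{tder}_3$ is a cocycle, and its class is non-zero and spans $H^3(\mathfrak{tder},d)$. -/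

import Mathlib

namespace TangentialDer

noncomputable section

/-! ### The degree-completed free Lie algebra -/

section Homogeneous

variable {k : Type*} [Field k] {n : ℕ}

/-- `IsLieWord d w`: `w` is a Lie word (iterated bracket of generators) with `d` letters. -/
inductive IsLieWord : ℕ → FreeLieAlgebra k (Fin n) → Prop
  | gen (i : Fin n) : IsLieWord 1 (FreeLieAlgebra.of k i)
  | brk {p q : ℕ} {a b : FreeLieAlgebra k (Fin n)} :
      IsLieWord p a → IsLieWord q b → IsLieWord (p + q) ⁅a, b⁆

variable (k n) in
/-- The degree `d` part of the free Lie algebra: the span of the Lie words with `d` letters. -/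
def lieHomog (d : ℕ) : Submodule k (FreeLieAlgebra k (Fin n)) :=
  Submodule.span k {w | IsLieWord d w}

theorem IsLieWord.mem {d : ℕ} {w : FreeLieAlgebra k (Fin n)} (h : IsLieWord d w) :
    w ∈ lieHomog k n d := Submodule.subset_span h

theorem IsLieWord.one_le {d : ℕ} {w : FreeLieAlgebra k (Fin n)} (h : IsLieWord d w) :
    1 ≤ d := by
  induction h with
  | gen i => exact le_rfl
  | brk _ _ h1 h2 => omega

theorem lieHomog_zero {a : FreeLieAlgebra k (Fin n)} (ha : a ∈ lieHomog k n 0) : a = 0 := by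
  have : {w : FreeLieAlgebra k (Fin n) | IsLieWord 0 w} = ∅ := by
    ext w
    simp only [Set.mem_ofPred_eq, Set.mem_empty_iff_false, iff_false]
    intro h
    have := h.one_le
    omega
  rw [lieHomog, this, Submodule.span_empty] at ha
  simpa using ha

theorem lie_mem_lieHomog {p q : ℕ} {a b : FreeLieAlgebra k (Fin n)}
    (ha : a ∈ lieHomog k n p) (hb : b ∈ lieHomog k n q) : ⁅a, b⁆ ∈ lieHomog k n (p + q) := by
  induction ha using Submodule.span_induction with
  | mem x hx =>
    induction hb using Submodule.span_induction with
    | mem y hy => exact (IsLieWord.brk hx hy).mem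
    | zero => simp
    | add y z _ _ h1 h2 => rw [lie_add]; exact add_mem h1 h2
    | smul c y _ h1 => rw [lie_smul]; exact Submodule.smul_mem _ _ h1
  | zero => simp
  | add y z _ _ h1 h2 => rw [add_lie]; exact add_mem h1 h2
  | smul c y _ h1 => rw [smul_lie]; exact Submodule.smul_mem _ _ h1

end Homogeneous

/-- The degree completion `∏_{d ≥ 1} lie^d(x_1, …, x_n)` of the free Lie algebra over `k` on
`n` generators (the factor with index `0` is the zero space). -/
def CLie (k : Type*) [Field k] (n : ℕ) : Type _ := (d : ℕ) → lieHomog k n d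

namespace CLie

variable {k : Type*} [Field k] {n m : ℕ}

instance : AddCommGroup (CLie k n) := inferInstanceAs (AddCommGroup ((d : ℕ) → lieHomog k n d))

instance : Module k (CLie k n) := inferInstanceAs (Module k ((d : ℕ) → lieHomog k n d))

/-- The homogeneous component of degree `d`, as an element of the free Lie algebra. -/
def comp (a : CLie k n) (d : ℕ) : FreeLieAlgebra k (Fin n) := (a d : FreeLieAlgebra k (Fin n))

/-- An element of the completion from the sequence of its homogeneous components. -/
def mk (f : ℕ → FreeLieAlgebra k (Fin n)) (hf : ∀ d, f d ∈ lieHomog k n d) : CLie k n :=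
  fun d => ⟨f d, hf d⟩

theorem comp_mem (a : CLie k n) (d : ℕ) : a.comp d ∈ lieHomog k n d := (a d).2

@[simp] theorem comp_mk (f : ℕ → FreeLieAlgebra k (Fin n)) (hf : ∀ d, f d ∈ lieHomog k n d)
    (d : ℕ) : (mk f hf).comp d = f d := rfl

@[ext] theorem ext {a b : CLie k n} (h : ∀ d, a.comp d = b.comp d) : a = b :=
  funext fun d => Subtype.ext (h d)

@[simp] theorem comp_zero (d : ℕ) : (0 : CLie k n).comp d = 0 := rfl
@[simp] theorem comp_add (a b : CLie k n) (d : ℕ) : (a + b).comp d = a.comp d + b.comp d := rfl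
@[simp] theorem comp_sub (a b : CLie k n) (d : ℕ) : (a - b).comp d = a.comp d - b.comp d := rfl
@[simp] theorem comp_neg (a : CLie k n) (d : ℕ) : (-a).comp d = -a.comp d := rfl
@[simp] theorem comp_smul (c : k) (a : CLie k n) (d : ℕ) : (c • a).comp d = c • a.comp d := rfl

variable (k n) in
/-- Taking the component of degree `d`, as a linear map. -/
def compₗ (d : ℕ) : CLie k n →ₗ[k] FreeLieAlgebra k (Fin n) where
  toFun a := a.comp d
  map_add' _ _ := rfl
  map_smul' _ _ := rfl

@[simp] theorem comp_sum {ι : Type*} (s : Finset ι) (f : ι → CLie k n) (d : ℕ) :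
    (∑ i ∈ s, f i).comp d = ∑ i ∈ s, (f i).comp d :=
  map_sum (compₗ k n d) f s

@[simp] theorem comp_zero_right (a : CLie k n) : a.comp 0 = 0 := lieHomog_zero (a.comp_mem 0)

theorem sum_triple {M : Type*} [AddCommMonoid M] (T : ℕ → ℕ → ℕ → M) (d : ℕ) :
    ∑ p ∈ Finset.HasAntidiagonal.antidiagonal d, ∑ q ∈ Finset.HasAntidiagonal.antidiagonal p.2, T p.1 q.1 q.2 =
      ∑ p ∈ Finset.HasAntidiagonal.antidiagonal d, ∑ q ∈ Finset.HasAntidiagonal.antidiagonal p.1, T q.1 q.2 p.2 := by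
  rw [Finset.sum_sigma', Finset.sum_sigma']
  refine Finset.sum_nbij' (fun x => ⟨(x.1.1 + x.2.1, x.2.2), (x.1.1, x.2.1)⟩)
    (fun x => ⟨(x.2.1, x.2.2 + x.1.2), (x.2.2, x.1.2)⟩) ?_ ?_ ?_ ?_ ?_
  all_goals
    rintro ⟨⟨a, b⟩, ⟨c, e⟩⟩ h
    simp only [Finset.mem_sigma, Finset.HasAntidiagonal.mem_antidiagonal] at h ⊢
  · exact ⟨by omega, trivial⟩
  · exact ⟨by omega, trivial⟩
  · obtain ⟨h1, h2⟩ := h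
    subst h2
    rfl
  · obtain ⟨h1, h2⟩ := h
    subst h2
    rfl

theorem sum_swap {M : Type*} [AddCommMonoid M] (T : ℕ → ℕ → M) (d : ℕ) :
    ∑ q ∈ Finset.HasAntidiagonal.antidiagonal d, T q.1 q.2 = ∑ q ∈ Finset.HasAntidiagonal.antidiagonal d, T q.2 q.1 :=
  (Finset.Nat.sum_antidiagonal_swap (f := fun q => T q.1 q.2)).symm

/-- The bracket, extended degree by degree: `⁅a, b⁆_d = ∑_{p+q=d} ⁅a_p, b_q⁆`. -/
instance : Bracket (CLie k n) (CLie k n) where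
  bracket a b := mk (fun d => ∑ p ∈ Finset.HasAntidiagonal.antidiagonal d, ⁅a.comp p.1, b.comp p.2⁆) fun d =>
    Submodule.sum_mem _ fun p hp => by
      rw [← Finset.HasAntidiagonal.mem_antidiagonal.1 hp]
      exact lie_mem_lieHomog (a.comp_mem _) (b.comp_mem _)

theorem comp_lie (a b : CLie k n) (d : ℕ) :
    ⁅a, b⁆.comp d = ∑ p ∈ Finset.HasAntidiagonal.antidiagonal d, ⁅a.comp p.1, b.comp p.2⁆ := rfl

instance : LieRing (CLie k n) where
  add_lie a b c := by ext d; simp [comp_lie, Finset.sum_add_distrib]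
  lie_add a b c := by ext d; simp [comp_lie, Finset.sum_add_distrib]
  lie_self a := by
    ext d
    rw [comp_lie, comp_zero]
    refine Finset.sum_involution (fun p _ => p.swap) ?_ ?_ ?_ ?_
    · intro p _
      rw [← lie_skew (a.comp p.1) (a.comp p.2)]
      exact neg_add_cancel _
    · intro p _ hp h
      apply hp
      have : p.2 = p.1 := congrArg Prod.fst h
      rw [this, lie_self]
    · intro p hp
      simpa [add_comm] using hp
    · intro p _
      simp
  leibniz_lie a b c := by
    ext d
    simp only [comp_lie, comp_add, lie_sum, sum_lie]
    rw [sum_triple (fun i j l => ⁅a.comp i, ⁅b.comp j, c.comp l⁆⁆),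
      sum_triple (fun i j l => ⁅b.comp i, ⁅a.comp j, c.comp l⁆⁆), ← Finset.sum_add_distrib]
    refine Finset.sum_congr rfl fun p _ => ?_
    rw [sum_swap (fun i j => ⁅b.comp i, ⁅a.comp j, c.comp p.2⁆⁆), ← Finset.sum_add_distrib]
    exact Finset.sum_congr rfl fun q _ => leibniz_lie _ _ _

instance : LieAlgebra k (CLie k n) where
  lie_smul t a b := by ext d; simp [comp_lie, Finset.smul_sum]

variable (k) in
/-- The generators `x_1, …, x_n` (indexed by `Fin n`, so from `0`). -/
def X (i : Fin n) : CLie k n :=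
  mk (fun d => if d = 1 then FreeLieAlgebra.of k i else 0) fun d => by
    split_ifs with h
    · subst h
      exact (IsLieWord.gen i).mem
    · exact zero_mem _

theorem comp_X (i : Fin n) (d : ℕ) :
    (X k i).comp d = if d = 1 then FreeLieAlgebra.of k i else 0 := rfl

theorem comp_X_lie (i : Fin n) (a : CLie k n) (d : ℕ) :
    ⁅X k i, a⁆.comp (d + 1) = ⁅FreeLieAlgebra.of k i, a.comp d⁆ := by
  rw [comp_lie, Finset.sum_eq_single (1, d)]
  · simp [comp_X]
  · rintro ⟨p, q⟩ hp hne
    have : p ≠ 1 := by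
      rintro rfl
      apply hne
      simp only [Finset.HasAntidiagonal.mem_antidiagonal] at hp
      ext <;> simp; omega
    simp [comp_X, this]
  · intro h
    simp [add_comm] at h

/-- `subst y a = a(y_1, …, y_n)`: substitution of elements `y_i` of degree one for the
generators. -/
def subst (y : Fin n → lieHomog k m 1) : CLie k n →ₗ[k] CLie k m where
  toFun a := mk (fun d => FreeLieAlgebra.lift k (fun i => (y i : FreeLieAlgebra k (Fin m)))
      (a.comp d)) fun d => by
    have key : ∀ w ∈ lieHomog k n d,
        FreeLieAlgebra.lift k (fun i => (y i : FreeLieAlgebra k (Fin m))) w ∈ lieHomog k m d := by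
      intro w hw
      induction hw using Submodule.span_induction with
      | mem x hx =>
        induction hx with
        | gen i => rw [FreeLieAlgebra.lift_of_apply]; exact (y i).2
        | brk _ _ h1 h2 => rw [LieHom.map_lie]; exact lie_mem_lieHomog h1 h2
      | zero => simp
      | add u v _ _ h1 h2 => rw [map_add]; exact add_mem h1 h2
      | smul c u _ h1 => rw [map_smul]; exact Submodule.smul_mem _ _ h1
    exact key _ (a.comp_mem d)
  map_add' a b := ext fun d => map_add _ (a.comp d) (b.comp d)
  map_smul' c a := ext fun d => map_smul _ c (a.comp d)

theorem comp_subst (y : Fin n → lieHomog k m 1) (a : CLie k n) (d : ℕ) :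
    (subst y a).comp d =
      FreeLieAlgebra.lift k (fun i => (y i : FreeLieAlgebra k (Fin m))) (a.comp d) := rfl

section Coefficient

attribute [local instance 100] LieRing.ofAssociativeRing

variable (k) in
/-- The coefficient of the generator `x_j` in an element of the free Lie algebra: the
homomorphism to the abelian Lie algebra `k` with `x_j ↦ 1` and `x_i ↦ 0` for `i ≠ j`. -/
def freeCoeff (j : Fin n) : FreeLieAlgebra k (Fin n) →ₗ[k] k :=
  (FreeLieAlgebra.lift k (Pi.single j (1 : k) : Fin n → k) : FreeLieAlgebra k (Fin n) →ₗ⁅k⁆ k)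

theorem freeCoeff_of (j i : Fin n) :
    freeCoeff k j (FreeLieAlgebra.of k i) = if i = j then 1 else 0 := by
  simp [freeCoeff, Pi.single_apply]

theorem freeCoeff_lie (j : Fin n) (a b : FreeLieAlgebra k (Fin n)) :
    freeCoeff k j ⁅a, b⁆ = 0 := by
  change (FreeLieAlgebra.lift k (Pi.single j (1 : k) : Fin n → k)) ⁅a, b⁆ = 0
  rw [LieHom.map_lie, LieRing.of_associative_ring_bracket, mul_comm, sub_self]

end Coefficient

theorem freeCoeff_eq_zero (j : Fin n) {d : ℕ} (hd : d ≠ 1) {a : FreeLieAlgebra k (Fin n)}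
    (ha : a ∈ lieHomog k n d) : freeCoeff k j a = 0 := by
  induction ha using Submodule.span_induction with
  | mem x hx =>
    cases hx with
    | gen i => exact absurd rfl hd
    | brk _ _ => exact freeCoeff_lie _ _ _
  | zero => simp
  | add u v _ _ h1 h2 => rw [map_add, h1, h2, add_zero]
  | smul c u _ h1 => rw [map_smul, h1, smul_zero]

variable (k) in
/-- The projection `p_j` taking the coefficient of `x_j` in the degree one part. -/
def proj (j : Fin n) : CLie k n →ₗ[k] k := freeCoeff k j ∘ₗ compₗ k n 1

theorem proj_apply (j : Fin n) (a : CLie k n) : proj k j a = freeCoeff k j (a.comp 1) := rfl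

theorem proj_X (j i : Fin n) : proj k j (X k i) = if i = j then 1 else 0 := by
  rw [proj_apply, comp_X, if_pos rfl, freeCoeff_of]

theorem proj_lie (j : Fin n) (a b : CLie k n) : proj k j ⁅a, b⁆ = 0 := by
  rw [proj_apply, comp_lie, map_sum]
  exact Finset.sum_eq_zero fun p _ => freeCoeff_lie _ _ _

theorem lieHomog_one {a : FreeLieAlgebra k (Fin n)} (ha : a ∈ lieHomog k n 1) :
    a = ∑ i, freeCoeff k i a • FreeLieAlgebra.of k i := by
  induction ha using Submodule.span_induction with
  | mem x hx =>
    generalize hd : 1 = d at hx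
    cases hx with
    | gen i => simp [freeCoeff_of]
    | brk h1 h2 =>
      have := h1.one_le
      have := h2.one_le
      omega
  | zero => simp
  | add u v _ _ h1 h2 =>
    conv_lhs => rw [h1, h2]
    simp [add_smul, Finset.sum_add_distrib]
  | smul c u _ h1 =>
    conv_lhs => rw [h1]
    simp [Finset.smul_sum, mul_smul]

/-- Every homogeneous element of degree at least two is a sum of brackets `⁅x_i, b_i⁆`. -/
theorem lieHomog_succ {d : ℕ} (hd : 1 ≤ d) {a : FreeLieAlgebra k (Fin n)}
    (ha : a ∈ lieHomog k n (d + 1)) :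
    ∃ b : Fin n → FreeLieAlgebra k (Fin n), (∀ i, b i ∈ lieHomog k n d) ∧
      a = ∑ i, ⁅FreeLieAlgebra.of k i, b i⁆ := by
  let T : ℕ → Submodule k (FreeLieAlgebra k (Fin n)) := fun e =>
    { carrier := {a | ∃ b : Fin n → FreeLieAlgebra k (Fin n), (∀ i, b i ∈ lieHomog k n e) ∧
        a = ∑ i, ⁅FreeLieAlgebra.of k i, b i⁆}
      zero_mem' := ⟨0, fun i => zero_mem _, by simp⟩
      add_mem' := by
        rintro _ _ ⟨b, hb, rfl⟩ ⟨c, hc, rfl⟩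
        exact ⟨b + c, fun i => add_mem (hb i) (hc i), by simp [Finset.sum_add_distrib]⟩
      smul_mem' := by
        rintro t _ ⟨b, hb, rfl⟩
        exact ⟨t • b, fun i => Submodule.smul_mem _ _ (hb i), by simp [Finset.smul_sum]⟩ }
  have key : ∀ {p : ℕ} {u : FreeLieAlgebra k (Fin n)}, IsLieWord p u → ∀ {q e : ℕ},
      p + q = e + 1 → ∀ v ∈ lieHomog k n q, ⁅u, v⁆ ∈ T e := by
    intro p u hu
    induction hu with
    | gen i =>
      intro q e he v hv
      obtain rfl : q = e := by omega
      refine ⟨Pi.single i v, fun j => ?_, ?_⟩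
      · by_cases h : j = i
        · subst h; simpa using hv
        · simp [h]
      · rw [Finset.sum_eq_single i]
        · simp
        · intro j _ hj; simp [hj]
        · simp
    | brk h1 h2 ih1 ih2 =>
      intro q e he v hv
      rw [lie_lie]
      exact sub_mem (ih1 (by omega) _ (lie_mem_lieHomog h2.mem hv))
        (ih2 (by omega) _ (lie_mem_lieHomog h1.mem hv))
  change a ∈ T d
  refine (Submodule.span_le (p := T d)).2 ?_ ha
  intro w hw
  have hw : IsLieWord (d + 1) w := hw
  generalize he : d + 1 = e at hw
  cases hw with
  | gen i => omega
  | brk h1 h2 => exact key h1 he.symm _ h2.mem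

/-- Every Lie series is a linear combination of generators plus a sum of `⁅x_i, b_i⁆`. -/
theorem decompose (a : CLie k n) :
    ∃ b : Fin n → CLie k n, a = ∑ i, proj k i a • X k i + ∑ i, ⁅X k i, b i⁆ := by
  have h : ∀ d : ℕ, ∃ b : Fin n → FreeLieAlgebra k (Fin n), (∀ i, b i ∈ lieHomog k n d) ∧
      (1 ≤ d → a.comp (d + 1) = ∑ i, ⁅FreeLieAlgebra.of k i, b i⁆) := by
    intro d
    by_cases hd : 1 ≤ d
    · obtain ⟨b, hb, h⟩ := lieHomog_succ hd (a.comp_mem (d + 1))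
      exact ⟨b, hb, fun _ => h⟩
    · exact ⟨0, fun i => zero_mem _, fun h => absurd h hd⟩
  choose b hb h using h
  refine ⟨fun i => mk (fun d => b d i) fun d => hb d i, ?_⟩
  ext d
  match d with
  | 0 => simp
  | 1 =>
    simp only [comp_add, comp_sum, comp_smul, comp_X, if_true]
    rw [Finset.sum_congr rfl fun i _ => comp_X_lie i _ 0]
    simp only [comp_zero_right, lie_zero, Finset.sum_const_zero, add_zero]
    exact lieHomog_one (a.comp_mem 1)
  | d + 2 =>
    simp only [comp_add, comp_sum, comp_smul, comp_X]
    rw [Finset.sum_congr rfl fun i _ => comp_X_lie i _ (d + 1)]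
    simpa using h (d + 1) (by omega)

/-- A derivation of the completed free Lie algebra is determined by its values on generators. -/
theorem derivation_ext {u v : LieDerivation k (CLie k n) (CLie k n)}
    (h : ∀ i, u (X k i) = v (X k i)) : u = v := by
  have key : ∀ (d : ℕ) (a : CLie k n), (u a).comp d = (v a).comp d := by
    intro d
    induction d with
    | zero => simp
    | succ d ih =>
      intro a
      obtain ⟨b, hb⟩ := decompose a
      rw [hb]
      simp only [map_add, map_sum, map_smul, LieDerivation.apply_lie_eq_sub, comp_add, comp_sum,
        comp_smul, comp_sub, comp_X_lie, ih, h]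
  exact LieDerivation.ext fun a => ext fun d => key d a

end CLie

section Free

/-! ### Two facts on free Lie algebras: derivations with prescribed values on the generators,
and the centralizer of a generator -/

attribute [local instance 100] LieRing.ofAssociativeRing

variable {k : Type*} [Field k] {n : ℕ}

/-- Auxiliary: `x_i` acts on `L × k` by `(l, t) ↦ (⁅x_i, l⁆ + t c_i, 0)`. -/
def genAct (c : Fin n → FreeLieAlgebra k (Fin n)) (i : Fin n) :
    Module.End k (FreeLieAlgebra k (Fin n) × k) where
  toFun z := (⁅FreeLieAlgebra.of k i, z.1⁆ + z.2 • c i, 0)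
  map_add' y z := by
    ext
    · simp only [Prod.fst_add, Prod.snd_add, lie_add, add_smul]; abel
    · simp
  map_smul' t z := by
    ext
    · simp [mul_smul]
    · simp

/-- Auxiliary: the derivation of the free Lie algebra with `x_i ↦ c_i`, as a linear map. -/
def freeDer (c : Fin n → FreeLieAlgebra k (Fin n)) :
    FreeLieAlgebra k (Fin n) →ₗ[k] FreeLieAlgebra k (Fin n) where
  toFun a := (FreeLieAlgebra.lift k (genAct c) a (0, 1)).1
  map_add' a b := by simp
  map_smul' t a := by simp

theorem lift_genAct (c : Fin n → FreeLieAlgebra k (Fin n)) {d : ℕ}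
    {a : FreeLieAlgebra k (Fin n)} (ha : a ∈ lieHomog k n d) (l : FreeLieAlgebra k (Fin n))
    (t : k) : FreeLieAlgebra.lift k (genAct c) a (l, t) = (⁅a, l⁆ + t • freeDer c a, 0) := by
  have key : ∀ a ∈ lieHomog k n d, (∀ l, FreeLieAlgebra.lift k (genAct c) a (l, 0) = (⁅a, l⁆, 0)) ∧
      (FreeLieAlgebra.lift k (genAct c) a (0, 1)).2 = 0 := by
    clear ha a
    intro a ha
    induction ha using Submodule.span_induction with
    | mem x hx =>
      induction hx with
      | gen i => rw [FreeLieAlgebra.lift_of_apply]; simp [genAct]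
      | @brk p q u v _ _ h1 h2 =>
        rw [LieHom.map_lie, LieRing.of_associative_ring_bracket]
        have e1 : FreeLieAlgebra.lift k (genAct c) u (0, 1) = (freeDer c u, 0) :=
          Prod.ext rfl h1.2
        have e2 : FreeLieAlgebra.lift k (genAct c) v (0, 1) = (freeDer c v, 0) :=
          Prod.ext rfl h2.2
        constructor
        · intro l
          simp [Module.End.mul_apply, h1.1, h2.1]
        · simp [Module.End.mul_apply, e1, e2, h1.1, h2.1]
    | zero => simp [Prod.ext_iff]
    | add u v _ _ h1 h2 => simp [h1.1, h1.2, h2.1, h2.2]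
    | smul c u _ h1 => simp [h1.1, h1.2]
  obtain ⟨h1, h2⟩ := key a ha
  have e1 : FreeLieAlgebra.lift k (genAct c) a (0, 1) = (freeDer c a, 0) := Prod.ext rfl h2
  have e2 : ((l, t) : FreeLieAlgebra k (Fin n) × k) = (l, 0) + t • (0, 1) := by simp
  rw [e2, map_add, map_smul, h1, e1]
  simp

theorem freeDer_of (c : Fin n → FreeLieAlgebra k (Fin n)) (i : Fin n) :
    freeDer c (FreeLieAlgebra.of k i) = c i := by
  simp [freeDer, genAct]

theorem freeDer_lie (c : Fin n → FreeLieAlgebra k (Fin n)) {p q : ℕ}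
    {a b : FreeLieAlgebra k (Fin n)} (ha : a ∈ lieHomog k n p) (hb : b ∈ lieHomog k n q) :
    freeDer c ⁅a, b⁆ = ⁅a, freeDer c b⁆ - ⁅b, freeDer c a⁆ := by
  change (FreeLieAlgebra.lift k (genAct c) ⁅a, b⁆ (0, 1)).1 = _
  rw [LieHom.map_lie, LieRing.of_associative_ring_bracket]
  simp [Module.End.mul_apply, lift_genAct c ha, lift_genAct c hb]

theorem freeDer_mem (c : Fin n → FreeLieAlgebra k (Fin n)) {e : ℕ}
    (hc : ∀ i, c i ∈ lieHomog k n (e + 1)) {d : ℕ} {a : FreeLieAlgebra k (Fin n)}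
    (ha : a ∈ lieHomog k n d) : freeDer c a ∈ lieHomog k n (e + d) := by
  induction ha using Submodule.span_induction with
  | mem x hx =>
    induction hx with
    | gen i => rw [freeDer_of]; exact hc i
    | @brk p q u v hu hv h1 h2 =>
      rw [freeDer_lie c hu.mem hv.mem]
      refine sub_mem ?_ ?_
      · have := lie_mem_lieHomog hu.mem h2
        rwa [show p + (e + q) = e + (p + q) by omega] at this
      · have := lie_mem_lieHomog hv.mem h1
        rwa [show q + (e + p) = e + (p + q) by omega] at this
  | zero => simp
  | add u v _ _ h1 h2 => rw [map_add]; exact add_mem h1 h2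
  | smul c u _ h1 => rw [map_smul]; exact Submodule.smul_mem _ _ h1

/-- The embedding of the free Lie algebra in the free associative algebra. -/
def toAssoc (k : Type*) [Field k] (n : ℕ) :
    FreeLieAlgebra k (Fin n) →ₗ⁅k⁆ FreeAlgebra k (Fin n) :=
  FreeLieAlgebra.lift k (FreeAlgebra.ι k)

theorem freeDer_euler {d : ℕ} {a : FreeLieAlgebra k (Fin n)} (ha : a ∈ lieHomog k n d) :
    freeDer (FreeLieAlgebra.of k) a = (d : k) • a := by
  induction ha using Submodule.span_induction with
  | mem x hx =>
    induction hx with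
    | gen i => simp [freeDer_of]
    | @brk p q u v hu hv h1 h2 =>
      rw [freeDer_lie _ hu.mem hv.mem, h1, h2, lie_smul, lie_smul, ← lie_skew v u]
      rw [Nat.cast_add, add_smul, smul_neg, ← lie_skew u v]
      simp only [smul_neg]
      abel
  | zero => simp
  | add u v _ _ h1 h2 => rw [map_add, h1, h2, smul_add]
  | smul c u _ h1 => rw [map_smul, h1, smul_comm]

theorem toAssoc_injective [CharZero k] {d : ℕ} {a : FreeLieAlgebra k (Fin n)}
    (ha : a ∈ lieHomog k n d) (h : toAssoc k n a = 0) : a = 0 := by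
  have key : FreeLieAlgebra.lift k (genAct (FreeLieAlgebra.of k)) a =
      FreeAlgebra.lift k (genAct (FreeLieAlgebra.of k)) (toAssoc k n a) := by
    have : FreeLieAlgebra.lift k (genAct (FreeLieAlgebra.of (X := Fin n) k)) =
        ((FreeAlgebra.lift k (genAct (FreeLieAlgebra.of k))).toLieHom).comp (toAssoc k n) := by
      refine FreeLieAlgebra.hom_ext fun i => ?_
      simp [toAssoc]
    rw [this]
    rfl
  rw [h, map_zero] at key
  have h2 : freeDer (FreeLieAlgebra.of k) a = 0 := by
    change (FreeLieAlgebra.lift k (genAct (FreeLieAlgebra.of k)) a (0, 1)).1 = 0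
    rw [key]
    rfl
  rw [freeDer_euler ha] at h2
  by_cases hd : d = 0
  · subst hd
    exact lieHomog_zero ha
  · exact (smul_eq_zero.1 h2).resolve_left (by exact_mod_cast hd)

/-- An element of the free associative algebra commuting with `x` is a polynomial in `x`. -/
theorem exists_aeval_of_commute (x : Fin n) (f : FreeAlgebra k (Fin n))
    (h : FreeAlgebra.ι k x * f = f * FreeAlgebra.ι k x) :
    ∃ q : Polynomial k, f = Polynomial.aeval (FreeAlgebra.ι k x) q := by
  let E := FreeAlgebra.equivMonoidAlgebraFreeMonoid (R := k) (X := Fin n)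
  have hE : E (FreeAlgebra.ι k x) = MonoidAlgebra.single (FreeMonoid.of x) 1 := by
    simp [E, FreeAlgebra.equivMonoidAlgebraFreeMonoid]
  set g := E f with hg
  have hgc : MonoidAlgebra.single (FreeMonoid.of x) 1 * g =
      g * MonoidAlgebra.single (FreeMonoid.of x) 1 := by
    rw [← hE, hg, ← map_mul, h, map_mul]
  have hrot : ∀ w, g.coeff w =
      (g * MonoidAlgebra.single (FreeMonoid.of x) 1).coeff (FreeMonoid.of x * w) := by
    intro w
    rw [← hgc, MonoidAlgebra.coeff_single_mul_mul, one_mul]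
  have key : ∀ (u : List (Fin n)) (m : ℕ),
      g.coeff (FreeMonoid.of x ^ m * FreeMonoid.ofList u) ≠ 0 → ∀ y ∈ u, y = x := by
    intro u
    induction u using List.reverseRecOn with
    | nil => simp
    | append_singleton u y ih =>
      intro m hm
      have e : FreeMonoid.of x * (FreeMonoid.of x ^ m * FreeMonoid.ofList (u ++ [y])) =
          (FreeMonoid.of x ^ (m + 1) * FreeMonoid.ofList u) * FreeMonoid.of y := by
        rw [FreeMonoid.ofList_append, FreeMonoid.ofList_singleton, pow_succ']
        simp only [mul_assoc]
      rw [hrot, e] at hm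
      by_cases hy : y = x
      · subst hy
        rw [MonoidAlgebra.coeff_mul_single_mul, mul_one] at hm
        intro z hz
        rcases List.mem_append.1 hz with hz | hz
        · exact ih _ hm z hz
        · simpa using hz
      · exfalso
        apply hm
        apply MonoidAlgebra.coeff_mul_single_of_forall_mul_ne
        intro v hv
        apply hy
        have := congrArg (fun l => (FreeMonoid.toList l).getLast?) hv
        simpa [FreeMonoid.toList_mul, eq_comm] using this
  have hpow : ∀ u : List (Fin n), (∀ y ∈ u, y = x) →
      FreeMonoid.ofList u = FreeMonoid.of x ^ u.length := by
    intro u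
    induction u with
    | nil => simp
    | cons y u ih =>
      intro h
      rw [FreeMonoid.ofList_cons, ih fun z hz => h z (List.mem_cons_of_mem _ hz),
        h y List.mem_cons_self, List.length_cons, pow_succ']
  have hsupp : ∀ w ∈ g.coeff.support, w = FreeMonoid.of x ^ w.length := by
    intro w hw
    exact hpow (FreeMonoid.toList w) (key (FreeMonoid.toList w) 0 (by simpa using hw))
  have hgs : g = ∑ w ∈ g.coeff.support,
      g.coeff w • (MonoidAlgebra.single (FreeMonoid.of x) (1 : k)) ^ w.length := by
    conv_lhs => rw [← MonoidAlgebra.sum_coeff_single g]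
    refine Finset.sum_congr rfl fun w hw => ?_
    rw [MonoidAlgebra.single_pow, ← hsupp w hw]
    simp
  refine ⟨∑ w ∈ g.coeff.support, g.coeff w • Polynomial.X ^ w.length, ?_⟩
  apply E.injective
  rw [← hg, map_sum, map_sum]
  conv_lhs => rw [hgs]
  refine Finset.sum_congr rfl fun w _ => ?_
  rw [map_smul, map_smul, map_pow, map_pow, Polynomial.aeval_X, hE]

/-- The centralizer of a generator `x_i` in the free Lie algebra is `k x_i`. -/
theorem eq_smul_of_lie_eq_zero [CharZero k] {d : ℕ} (i : Fin n) {a : FreeLieAlgebra k (Fin n)}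
    (ha : a ∈ lieHomog k n d) (h : ⁅FreeLieAlgebra.of k i, a⁆ = 0) :
    a = CLie.freeCoeff k i a • FreeLieAlgebra.of k i := by
  obtain ⟨q, hq⟩ := exists_aeval_of_commute i (toAssoc k n a) (by
    have := congrArg (toAssoc k n) h
    rw [LieHom.map_lie, LieRing.of_associative_ring_bracket, map_zero, sub_eq_zero] at this
    simpa [toAssoc] using this)
  let ψ : FreeAlgebra k (Fin n) →ₐ[k] Polynomial k :=
    FreeAlgebra.lift k (fun j => if j = i then Polynomial.X else 0)
  have hψ : ∀ {e : ℕ} {b : FreeLieAlgebra k (Fin n)}, b ∈ lieHomog k n e →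
      ψ (toAssoc k n b) = CLie.freeCoeff k i b • Polynomial.X := by
    intro e b hb
    induction hb using Submodule.span_induction with
    | mem x hx =>
      cases hx with
      | gen j => by_cases hj : j = i <;> simp [ψ, toAssoc, CLie.freeCoeff_of, hj]
      | brk _ _ =>
        rw [CLie.freeCoeff_lie, LieHom.map_lie, LieRing.of_associative_ring_bracket, map_sub,
          map_mul, map_mul, mul_comm, sub_self, zero_smul]
    | zero => simp
    | add u v _ _ h1 h2 => rw [map_add, map_add, map_add, h1, h2, add_smul]
    | smul c u _ h1 => rw [map_smul, map_smul, map_smul, h1, smul_assoc]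
  have hq2 : q = CLie.freeCoeff k i a • Polynomial.X := by
    rw [← hψ ha, hq, ← Polynomial.aeval_algHom_apply]
    simp [ψ]
  have h0 : toAssoc k n a = toAssoc k n (CLie.freeCoeff k i a • FreeLieAlgebra.of k i) := by
    rw [hq, hq2]
    simp [toAssoc]
  by_cases hd : d = 1
  · subst hd
    rw [← sub_eq_zero]
    refine toAssoc_injective (sub_mem ha (Submodule.smul_mem _ _ (IsLieWord.gen i).mem)) ?_
    rw [map_sub, h0, sub_self]
  · rw [CLie.freeCoeff_eq_zero i hd ha, zero_smul, map_zero] at h0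
    rw [CLie.freeCoeff_eq_zero i hd ha, zero_smul]
    exact toAssoc_injective ha h0

end Free

/-! ### Tangential derivations -/

section Tangential

variable {k : Type*} [Field k] {n m : ℕ}

open CLie

variable (k n) in
/-- The space of tangential derivations: derivations `u` of the completed free Lie algebra such
that for some `a_1, …, a_n` one has `u(x_i) = ⁅x_i, a_i⁆` for all `i`. -/
def dert : Submodule k (LieDerivation k (CLie k n) (CLie k n)) where
  carrier := {u | ∃ a : Fin n → CLie k n, ∀ i, u (X k i) = ⁅X k i, a i⁆}
  zero_mem' := ⟨0, fun i => by simp⟩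
  add_mem' := by
    rintro u v ⟨a, ha⟩ ⟨b, hb⟩
    exact ⟨a + b, fun i => by simp [ha, hb]⟩
  smul_mem' := by
    rintro t u ⟨a, ha⟩
    exact ⟨t • a, fun i => by simp [ha]⟩

variable (k n) in
/-- The space of `n`-tuples `(a_1, …, a_n)` of elements of the completed free Lie algebra with
`p_i(a_i) = 0` for all `i`. -/
def normTuple : Submodule k (Fin n → CLie k n) where
  carrier := {a | ∀ i, proj k i (a i) = 0}
  zero_mem' := fun i => by simp
  add_mem' ha hb := fun i => by simp [ha i, hb i]
  smul_mem' t a ha := fun i => by simp [ha i]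

/-- The derivation of the completed free Lie algebra with `x_i ↦ ⁅x_i, a_i⁆`. -/
def derOfTuple (a : Fin n → CLie k n) : LieDerivation k (CLie k n) (CLie k n) where
  toFun b := CLie.mk (fun d => ∑ p ∈ Finset.HasAntidiagonal.antidiagonal d,
      freeDer (fun i => ⁅FreeLieAlgebra.of k i, (a i).comp p.1⁆) (b.comp p.2)) fun d =>
    Submodule.sum_mem _ fun p hp => by
      rw [← Finset.HasAntidiagonal.mem_antidiagonal.1 hp]
      refine freeDer_mem _ (fun i => ?_) (b.comp_mem _)
      rw [add_comm]
      exact lie_mem_lieHomog (IsLieWord.gen i).mem ((a i).comp_mem _)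
  map_add' b c := CLie.ext fun d => by
    rw [comp_add, comp_mk, comp_mk, comp_mk]
    simp [Finset.sum_add_distrib]
  map_smul' t b := CLie.ext fun d => by
    rw [RingHom.id_apply, comp_smul, comp_mk, comp_mk]
    simp [Finset.smul_sum]
  leibniz' b c := by
    refine CLie.ext fun d => ?_
    let D : ℕ → FreeLieAlgebra k (Fin n) →ₗ[k] FreeLieAlgebra k (Fin n) := fun e =>
      freeDer (fun i => ⁅FreeLieAlgebra.of k i, (a i).comp e⁆)
    have hD : ∀ e p q, D e ⁅b.comp p, c.comp q⁆ =
        ⁅b.comp p, D e (c.comp q)⁆ - ⁅c.comp q, D e (b.comp p)⁆ := fun e p q =>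
      freeDer_lie _ (b.comp_mem p) (c.comp_mem q)
    change ∑ p ∈ Finset.HasAntidiagonal.antidiagonal d, D p.1 (⁅b, c⁆.comp p.2) =
      ∑ p ∈ Finset.HasAntidiagonal.antidiagonal d,
        ⁅b.comp p.1, ∑ q ∈ Finset.HasAntidiagonal.antidiagonal p.2, D q.1 (c.comp q.2)⁆ -
      ∑ p ∈ Finset.HasAntidiagonal.antidiagonal d,
        ⁅c.comp p.1, ∑ q ∈ Finset.HasAntidiagonal.antidiagonal p.2, D q.1 (b.comp q.2)⁆
    simp only [comp_lie, map_sum, lie_sum, hD, Finset.sum_sub_distrib]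
    congr 1
    · rw [sum_triple (fun e p q => ⁅b.comp p, D e (c.comp q)⁆),
        sum_triple (fun p e q => ⁅b.comp p, D e (c.comp q)⁆)]
      exact Finset.sum_congr rfl fun p _ => sum_swap (fun i j => ⁅b.comp j, D i (c.comp p.2)⁆) _
    · rw [Finset.sum_congr rfl fun p _ =>
          sum_swap (fun i j => ⁅c.comp j, D p.1 (b.comp i)⁆) p.2,
        sum_triple (fun e q p => ⁅c.comp q, D e (b.comp p)⁆),
        sum_triple (fun q e p => ⁅c.comp q, D e (b.comp p)⁆)]
      exact Finset.sum_congr rfl fun p _ => sum_swap (fun i j => ⁅c.comp j, D i (b.comp p.2)⁆) _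

theorem derOfTuple_X (a : Fin n → CLie k n) (i : Fin n) :
    derOfTuple a (X k i) = ⁅X k i, a i⁆ := by
  refine CLie.ext fun d => ?_
  change ∑ p ∈ Finset.HasAntidiagonal.antidiagonal d,
      freeDer (fun i => ⁅FreeLieAlgebra.of k i, (a i).comp p.1⁆) ((X k i).comp p.2) =
    ∑ p ∈ Finset.HasAntidiagonal.antidiagonal d, ⁅(X k i).comp p.1, (a i).comp p.2⁆
  rw [sum_swap (fun p q => ⁅(X k i).comp p, (a i).comp q⁆)]
  refine Finset.sum_congr rfl fun p _ => ?_
  rw [comp_X]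
  split_ifs
  · rw [freeDer_of]
  · simp

variable [CharZero k]

/-- The centralizer of `x_i` in the completed free Lie algebra is `k x_i`. -/
theorem eq_zero_of_lie_X_eq_zero (i : Fin n) {a : CLie k n} (h : ⁅X k i, a⁆ = 0)
    (hp : proj k i a = 0) : a = 0 := by
  refine CLie.ext fun d => ?_
  have h1 : ⁅FreeLieAlgebra.of k i, a.comp d⁆ = 0 := by rw [← comp_X_lie, h, comp_zero]
  have h2 : freeCoeff k i (a.comp d) = 0 := by
    by_cases hd : d = 1
    · subst hd
      exact hp
    · exact freeCoeff_eq_zero i hd (a.comp_mem d)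
  rw [eq_smul_of_lie_eq_zero i (a.comp_mem d) h1, h2, zero_smul, comp_zero]

variable (k n) in
/-- The one-to-one correspondence between normalized `n`-tuples and tangential derivations:
`(a_1, …, a_n)` corresponds to the derivation `x_i ↦ ⁅x_i, a_i⁆`. -/
def tupleEquiv : normTuple k n ≃ₗ[k] dert k n :=
  LinearEquiv.ofBijective
    { toFun := fun a => ⟨derOfTuple a.1, a.1, derOfTuple_X a.1⟩
      map_add' := fun a b => Subtype.ext <| derivation_ext fun i => by simp [derOfTuple_X]
      map_smul' := fun t a => Subtype.ext <| derivation_ext fun i => by simp [derOfTuple_X] } <| by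
    constructor
    · rw [← LinearMap.ker_eq_bot, LinearMap.ker_eq_bot']
      intro a ha
      have ha' : derOfTuple a.1 = 0 := congrArg Subtype.val ha
      refine Subtype.ext (funext fun i => eq_zero_of_lie_X_eq_zero i ?_ (a.2 i))
      rw [← derOfTuple_X, ha']
      rfl
    · rintro ⟨u, a, ha⟩
      refine ⟨⟨fun i => a i - proj k i (a i) • X k i, fun i => ?_⟩, ?_⟩
      · simp [proj_X]
      · refine Subtype.ext (derivation_ext fun i => ?_)
        change derOfTuple _ (X k i) = u (X k i)
        rw [derOfTuple_X, ha i]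
        simp

theorem tupleEquiv_X (a : normTuple k n) (i : Fin n) :
    (tupleEquiv k n a).1 (X k i) = ⁅X k i, a.1 i⁆ := derOfTuple_X a.1 i

end Tangential

/-! ### Simplicial and coproduct maps, the differential and its cohomology -/

section Differential

variable {k : Type*} [Field k] {l m n : ℕ}

open CLie

variable (k) in
/-- For a partially defined map `φ : {1, …, m} ⇀ {1, …, n}`, the linear form
`∑_{φ(j) = i} x_j`. -/
def fiberSum (φ : Fin m → Option (Fin n)) (i : Fin n) : lieHomog k m 1 :=
  ⟨∑ j with φ j = some i, FreeLieAlgebra.of k j,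
    Submodule.sum_mem _ fun j _ => (IsLieWord.gen j).mem⟩

/-- The component `b` of a tuple is carried by the partial map `φ` to `b(y_1, …, y_n)` where
`y_i` is the sum of the generators `x_j` with `φ(j) = i`. -/
def substFiber (φ : Fin m → Option (Fin n)) : CLie k n →ₗ[k] CLie k m := subst (fiberSum k φ)

theorem proj_substFiber (φ : Fin m → Option (Fin n)) (b : CLie k n) (j : Fin m) :
    proj k j (substFiber φ b) = ∑ i, if φ j = some i then proj k i b else 0 := by
  rw [proj_apply, substFiber, comp_subst]
  conv_lhs => rw [lieHomog_one (b.comp_mem 1)]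
  simp only [map_sum, map_smul, FreeLieAlgebra.lift_of_apply, fiberSum, freeCoeff_of, smul_eq_mul]
  refine Finset.sum_congr rfl fun i _ => ?_
  rw [Finset.sum_ite_eq']
  simp [proj_apply]

/-- The map on normalized tuples induced by a partially defined map
`φ : {1, …, m} ⇀ {1, …, n}`: the `j`-th component of the image of `(a_1, …, a_n)` is
`a_{φ(j)}(y_1, …, y_n)` with `y_i = ∑_{φ(l) = i} x_l`, and `0` where `φ(j)` is not defined. -/
def tuplePull (φ : Fin m → Option (Fin n)) : normTuple k n →ₗ[k] normTuple k m where
  toFun a := ⟨fun j => (φ j).elim 0 fun i => substFiber φ (a.1 i), fun j => by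
    cases h : φ j with
    | none => simp [h]
    | some i =>
      have hi := a.2 i
      simp [proj_substFiber, h, hi]⟩
  map_add' a b := by
    ext1
    funext j
    cases h : φ j <;> simp [h]
  map_smul' t a := by
    ext1
    funext j
    cases h : φ j <;> simp [h]

theorem tuplePull_apply (φ : Fin m → Option (Fin n)) (a : normTuple k n) (j : Fin m) :
    (tuplePull φ a).1 j = (φ j).elim 0 fun i => substFiber φ (a.1 i) := rfl

theorem tuplePull_tuplePull (φ : Fin m → Option (Fin n)) (ψ : Fin l → Option (Fin m))
    (a : normTuple k n) :
    tuplePull ψ (tuplePull φ a) = tuplePull (fun j => (ψ j).bind φ) a := by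
  have hs : ∀ b : CLie k n,
      substFiber ψ (substFiber φ b) = substFiber (fun j => (ψ j).bind φ) b := by
    intro b
    refine CLie.ext fun d => ?_
    simp only [substFiber, comp_subst]
    rw [← LieHom.comp_apply]
    congr 1
    refine FreeLieAlgebra.hom_ext fun i => ?_
    simp only [LieHom.comp_apply, FreeLieAlgebra.lift_of_apply, fiberSum, map_sum]
    simp only [Finset.sum_filter]
    simp only [Finset.ite_sum_zero]
    rw [Finset.sum_comm]
    refine Finset.sum_congr rfl fun q _ => ?_
    cases ψ q with
    | none => simp
    | some r =>
      rw [Finset.sum_eq_single r]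
      · simp
      · intro j _ hj
        simp [Ne.symm hj]
      · simp
  refine Subtype.ext (funext fun j => ?_)
  simp only [tuplePull_apply]
  cases h : ψ j with
  | none => simp
  | some i =>
    simp only [Option.elim_some, Option.bind_some]
    cases h2 : φ i with
    | none => simp
    | some r => simp [hs]

/-- `{1, …, n+1} ⇀ {1, …, n}`, not defined at `1`, and `j + 1 ↦ j`. -/
def dropFirst (n : ℕ) : Fin (n + 1) → Option (Fin n) := Fin.cases none some

/-- `{1, …, n+1} ⇀ {1, …, n}`, not defined at `n + 1`, and `j ↦ j` for `j ≤ n`. -/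
def dropLast (n : ℕ) : Fin (n + 1) → Option (Fin n) := Fin.lastCases none some

/-- `{1, …, n+1} → {1, …, n}`, the monotone surjection which identifies `i` with `i + 1`. -/
def merge {n : ℕ} (i : Fin n) : Fin (n + 1) → Option (Fin n) := fun j => some (i.predAbove j)

variable [CharZero k]

/-- The map on tangential derivations induced by a partially defined map. -/
def dertPull (φ : Fin m → Option (Fin n)) : dert k n →ₗ[k] dert k m :=
  (tupleEquiv k m).toLinearMap ∘ₗ tuplePull φ ∘ₗ (tupleEquiv k n).symm.toLinearMap

/-- The simplicial map `u ↦ u^{2,3,…,n+1} = (0, a_1(x_2, …, x_{n+1}), …, a_n(x_2, …, x_{n+1}))`. -/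
def simplicialFirst (n : ℕ) : dert k n →ₗ[k] dert k (n + 1) := dertPull (dropFirst n)

/-- The simplicial map `u ↦ u^{1,2,…,n} = (a_1, …, a_n, 0)`. -/
def simplicialLast (n : ℕ) : dert k n →ₗ[k] dert k (n + 1) := dertPull (dropLast n)

/-- The coproduct map `u ↦ u^{1,…,i(i+1),…,n+1}`: in the components
`(a_1, …, a_i, a_i, …, a_n)` the elements `x_1, …, x_i + x_{i+1}, …, x_{n+1}` are substituted for
the generators. -/
def coproduct {n : ℕ} (i : Fin n) : dert k n →ₗ[k] dert k (n + 1) := dertPull (merge i)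

variable (k) in
/-- The differential `d : dert_n → dert_{n+1}`,
`d u = u^{2,…,n+1} - u^{12,…,n+1} + … + (-1)^n u^{1,…,n(n+1)} + (-1)^{n+1} u^{1,…,n}`. -/
def d (n : ℕ) : dert k n →ₗ[k] dert k (n + 1) :=
  simplicialFirst n + ∑ i : Fin n, (-1 : k) ^ (i.1 + 1) • coproduct i +
    (-1 : k) ^ (n + 1) • simplicialLast n

/-- Uniform description of `dropFirst`, `merge` and `dropLast`, used for `d ∘ d = 0` only. -/
def coface (n i : ℕ) (j : Fin (n + 1)) : Option (Fin n) :=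
  if j.1 < i then (if h : j.1 < n then some ⟨j.1, h⟩ else none)
  else (if h : 1 ≤ j.1 then some ⟨j.1 - 1, by omega⟩ else none)

theorem coface_first (n : ℕ) : coface n 0 = dropFirst n := by
  funext j
  refine Fin.cases ?_ (fun j => ?_) j <;> simp [coface, dropFirst]

theorem coface_last (n : ℕ) : coface n (n + 1) = dropLast n := by
  funext j
  refine Fin.lastCases ?_ (fun j => ?_) j
  · simp [coface, dropLast]
  · simp only [coface, dropLast, Fin.lastCases_castSucc, Fin.val_castSucc]
    rw [if_pos (by omega), dif_pos j.2]

theorem coface_merge {n : ℕ} (i : Fin n) : coface n (i.1 + 1) = merge i := by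
  funext j
  simp only [coface, merge, Fin.predAbove, Fin.lt_def, Fin.val_castSucc]
  split_ifs <;> first | omega | rfl

theorem d_eq_sum (n : ℕ) :
    d k n = ∑ i ∈ Finset.range (n + 2), (-1 : k) ^ i • dertPull (coface n i) := by
  rw [Finset.sum_range_succ, Finset.sum_range_succ', coface_first, coface_last, d,
    ← Fin.sum_univ_eq_sum_range (fun i => (-1 : k) ^ (i + 1) • dertPull (coface n (i + 1)))]
  simp only [coface_merge, pow_zero, one_smul, simplicialFirst, simplicialLast, coproduct]
  rw [add_comm (dertPull (dropFirst n))]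

theorem dertPull_dertPull (φ : Fin m → Option (Fin n)) (ψ : Fin l → Option (Fin m))
    (u : dert k n) :
    dertPull ψ (dertPull φ u) = dertPull (fun j => (ψ j).bind φ) u := by
  simp [dertPull, tuplePull_tuplePull]

theorem coface_coface (n : ℕ) {i j : ℕ} (hij : i ≤ j) (x : Fin (n + 2)) :
    (coface (n + 1) i x).bind (coface n j) = (coface (n + 1) (j + 1) x).bind (coface n i) := by
  unfold coface
  split_ifs <;> simp only [Option.bind_some, Option.bind_none] <;> split_ifs <;>
    first | rfl | (exfalso; omega)

/-- `d` is a differential: `d ∘ d = 0`. -/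
theorem d_comp_d (n : ℕ) : d k (n + 1) ∘ₗ d k n = 0 := by
  ext1 u
  simp only [LinearMap.comp_apply, LinearMap.zero_apply, d_eq_sum, LinearMap.sum_apply,
    LinearMap.smul_apply, map_sum, map_smul, dertPull_dertPull]
  rw [Finset.sum_congr rfl fun j _ => Finset.smul_sum, ← Finset.sum_product']
  refine Finset.sum_involution
    (fun p _ => if p.2 ≤ p.1 then (p.2, p.1 + 1) else (p.2 - 1, p.1)) ?_ ?_ ?_ ?_
  · rintro ⟨j, i⟩ _
    by_cases h : i ≤ j
    · simp only [h, if_true]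
      rw [funext fun x => coface_coface n h x, smul_smul, smul_smul, ← add_smul, pow_succ]
      ring_nf
      simp
    · obtain ⟨i, rfl⟩ : ∃ s, i = s + 1 := ⟨i - 1, by omega⟩
      simp only [h, if_false, Nat.add_sub_cancel]
      rw [funext fun x => coface_coface n (show j ≤ i by omega) x, smul_smul, smul_smul,
        ← add_smul, pow_succ]
      ring_nf
      simp
  · rintro ⟨j, i⟩ _ _ he
    split_ifs at he <;> simp only [Prod.mk.injEq] at he <;> omega
  · rintro ⟨j, i⟩ hp
    simp only [Finset.mem_product, Finset.mem_range] at hp ⊢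
    split_ifs <;> simp only <;> omega
  · rintro ⟨j, i⟩ _
    by_cases h : i ≤ j
    · have h1 : ¬ j + 1 ≤ i := by omega
      simp [h, h1]
    · have h1 : j ≤ i - 1 := by omega
      have h2 : i - 1 + 1 = i := by omega
      simp [h, h1, h2]

/-- The coboundaries: the image of `d : dert_{n-1} → dert_n` (zero for `n = 0`). -/
def coboundaries (k : Type*) [Field k] [CharZero k] : (n : ℕ) → Submodule k (dert k n)
  | 0 => ⊥
  | n + 1 => LinearMap.range (d k n)

/-- The cohomology
`H^n(dert, d) = ker (d : dert_n → dert_{n+1}) / im (d : dert_{n-1} → dert_n)`. -/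
abbrev cohomology (k : Type*) [Field k] [CharZero k] (n : ℕ) : Type _ :=
  LinearMap.ker (d k n) ⧸ (coboundaries k n).submoduleOf (LinearMap.ker (d k n))

/-! ### The elements `r`, `t` and the cocycle `(0, [z, x], 0)` -/

variable (k)

/-- `r = (y, 0) ∈ dert_2`, where `x = X k 0` and `y = X k 1`. -/
def r : dert k 2 := tupleEquiv k 2 ⟨![X k 1, 0], fun i => by fin_cases i <;> simp [proj_X]⟩

/-- `t = (y, x) ∈ dert_2`. -/
def t : dert k 2 := tupleEquiv k 2 ⟨![X k 1, X k 0], fun i => by fin_cases i <;> simp [proj_X]⟩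

/-- `(0, [z, x], 0) ∈ dert_3`, where `x = X k 0` and `z = X k 2`. -/
def zxElt : dert k 3 :=
  tupleEquiv k 3 ⟨![0, ⁅X k 2, X k 0⁆, 0], fun i => by
    fin_cases i
    exacts [map_zero _, proj_lie _ _ _, map_zero _]⟩

end Differential

end
end TangentialDer

/-!
Write `u = (u₁, …, uₙ)` with all `uᵢ` homogeneous of degree `e`, and let `f (w₀ w₁ … w_e)` be the
coefficient of `w₁ … w_e` in `u_{w₀}`. Each operation `u ↦ u^φ` entering `d` becomes precomposition
of `f` with a partial map of the letters (and `0` where it is undefined), so `d` extends to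
arbitrary functions of words of length `e + 1`. A word of length `e + 1` in `n + 1` letters is a
chain `S₀ ⊆ ⋯ ⊆ S_{n-1}` of subsets of its `e + 1` positions, so this larger complex computes the
cohomology of the poset of nonempty proper subsets of the positions, which is a sphere of dimension
`e - 1`. In characteristic zero the normalised Dynkin map is a retraction of the larger complex
onto the homogeneous tangential derivations which commutes with `d`, so it remains to look at
spheres.

For `n = 2` the kernel lives in degree `e = 1`, because the poset is connected if there are at least
three positions. For `n = 3` every `1`-cocycle of the poset has a potential unless there are exactly
three positions. There the poset is a hexagon, and the alternating sum over the six words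
`w₀ w₁ w₂` that are permutations of the letters is integration around it. This sum vanishes on
coboundaries and is `2` on `(0, [z, x], 0)`.
-/

namespace TangentialDer

noncomputable section

open CLie

/-! ### Functions of words and homogeneous elements of the free associative algebra -/

section Words

variable {R X Y : Type*} [CommSemiring R]

/-- The noncommutative monomial `x_{w_1} ⋯ x_{w_e}` of a word `w`. -/
def wordProd (R : Type*) [CommSemiring R] {X : Type*} {e : ℕ} (w : Fin e → X) : FreeAlgebra R X :=
  (List.ofFn fun p => FreeAlgebra.ι R (w p)).prod

theorem basisFreeMonoid_ofList_ofFn {e : ℕ} (w : Fin e → X) :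
    FreeAlgebra.basisFreeMonoid R X (FreeMonoid.ofList (List.ofFn w)) = wordProd R w := by
  simp [FreeAlgebra.basisFreeMonoid, wordProd, FreeAlgebra.equivMonoidAlgebraFreeMonoid,
    FreeMonoid.lift_apply, List.map_ofFn, Function.comp_def]

theorem wordProd_cons {e : ℕ} (i : X) (w : Fin e → X) :
    wordProd R (Fin.cons i w : Fin (e + 1) → X) = FreeAlgebra.ι R i * wordProd R w := by
  simp [wordProd, List.ofFn_succ]

/-- The coefficients of an element of the free associative algebra at the words with `e` letters. -/
def wordCoeff (R X : Type*) [CommSemiring R] (e : ℕ) :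
    FreeAlgebra R X →ₗ[R] (Fin e → X) → R :=
  LinearMap.pi fun w =>
    (FreeAlgebra.basisFreeMonoid R X).coord (FreeMonoid.ofList (List.ofFn w))

theorem wordCoeff_wordProd [DecidableEq X] {e : ℕ} (v w : Fin e → X) :
    wordCoeff R X e (wordProd R v) w = if v = w then 1 else 0 := by
  classical
  simp [wordCoeff, ← basisFreeMonoid_ofList_ofFn, Finsupp.single_apply,
    List.ofFn_injective.eq_iff]

section WordSum

variable [Fintype X]

/-- The homogeneous noncommutative polynomial with prescribed coefficients. -/
def wordSum (R X : Type*) [CommSemiring R] [Fintype X] (e : ℕ) :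
    ((Fin e → X) → R) →ₗ[R] FreeAlgebra R X :=
  Fintype.linearCombination R (wordProd R)

theorem wordSum_apply {e : ℕ} (g : (Fin e → X) → R) :
    wordSum R X e g = ∑ w, g w • wordProd R w := rfl

theorem wordSum_zero (g : (Fin 0 → X) → R) :
    wordSum R X 0 g = algebraMap R _ (g Fin.elim0) := by
  rw [wordSum_apply, Fintype.sum_unique, Algebra.algebraMap_eq_smul_one]
  exact congrArg₂ _ (congrArg g (Subsingleton.elim _ _)) (by simp [wordProd])

theorem wordSum_succ {e : ℕ} (g : (Fin (e + 1) → X) → R) :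
    wordSum R X (e + 1) g =
      ∑ i, FreeAlgebra.ι R i * wordSum R X e fun w => g (Fin.cons i w) := by
  simp only [wordSum_apply, Finset.mul_sum, mul_smul_comm, ← wordProd_cons]
  rw [← Fintype.sum_prod_type', ← (Fin.consEquiv fun _ => X).sum_comp]
  rfl

theorem wordCoeff_wordSum {e : ℕ} (g : (Fin e → X) → R) :
    wordCoeff R X e (wordSum R X e g) = g := by
  classical
  funext w
  simp [wordSum_apply, wordCoeff_wordProd]

theorem range_wordSum (e : ℕ) :
    LinearMap.range (wordSum R X e) =
      Submodule.span R (Set.range (FreeAlgebra.ι R : X → FreeAlgebra R X)) ^ e := by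
  rw [wordSum, Fintype.range_linearCombination, Submodule.span_pow]
  congr 1
  ext b
  rw [Set.mem_pow]
  constructor
  · rintro ⟨w, rfl⟩
    exact ⟨fun p => ⟨_, w p, rfl⟩, rfl⟩
  · rintro ⟨f, rfl⟩
    choose w hw using fun p => (f p).2
    exact ⟨w, by simp only [wordProd, hw]⟩

theorem wordSum_wordCoeff {e : ℕ} {b : FreeAlgebra R X}
    (hb : b ∈ Submodule.span R (Set.range (FreeAlgebra.ι R : X → FreeAlgebra R X)) ^ e) :
    wordSum R X e (wordCoeff R X e b) = b := by
  rw [← range_wordSum] at hb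
  obtain ⟨g, rfl⟩ := hb
  rw [wordCoeff_wordSum]

end WordSum

/-! ### Substitution along a partial map of the letters -/

open Classical in
/-- The pullback of a function of words along a partially defined map `φ` of the letters: its
value at `w` is the value of the given function at `φ ∘ w`, or zero if `φ` is undefined at some
letter of `w`. -/
def wordPull {α : Type*} (φ : Y → Option X) : ((α → X) → R) →ₗ[R] (α → Y) → R where
  toFun g w := if h : ∀ p, (φ (w p)).isSome then g fun p => (φ (w p)).get (h p) else 0
  map_add' g h := by
    funext w
    by_cases hw : ∀ p, (φ (w p)).isSome <;> simp [hw]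
  map_smul' c g := by
    funext w
    by_cases hw : ∀ p, (φ (w p)).isSome <;> simp [hw]

theorem wordPull_of_forall_eq_some {α : Type*} {φ : Y → Option X} (g : (α → X) → R)
    {w : α → Y} {v : α → X} (h : ∀ p, φ (w p) = some (v p)) : wordPull φ g w = g v := by
  simp [wordPull, h]

theorem wordPull_of_eq_none {α : Type*} {φ : Y → Option X} (g : (α → X) → R) {w : α → Y} {p : α}
    (h : φ (w p) = none) : wordPull φ g w = 0 :=
  dif_neg fun hw => by simpa [h] using hw p

theorem wordPull_cons {e : ℕ} (φ : Y → Option X) (g : (Fin (e + 1) → X) → R) (j : Y) :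
    (fun w : Fin e → Y => wordPull φ g (Fin.cons j w)) =
      (φ j).elim 0 fun i => wordPull φ fun v => g (Fin.cons i v) := by
  funext w
  rcases hj : φ j with _ | i
  · exact wordPull_of_eq_none g (p := 0) hj
  rw [Option.elim_some]
  by_cases hw : ∀ p, (φ (w p)).isSome
  · choose v hv using fun p => Option.isSome_iff_exists.1 (hw p)
    rw [wordPull_of_forall_eq_some _ hv]
    exact wordPull_of_forall_eq_some g (Fin.cases hj hv)
  · obtain ⟨p, hp⟩ := not_forall.1 hw
    rw [Option.not_isSome_iff_eq_none] at hp
    rw [wordPull_of_eq_none _ hp]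
    exact wordPull_of_eq_none g (p := p.succ) hp

variable [Fintype Y] [DecidableEq X]

/-- The substitution `x_i ↦ ∑_{φ(j) = i} x_j` on free associative algebras. -/
def assocSubst (R : Type*) [CommSemiring R] (φ : Y → Option X) :
    FreeAlgebra R X →ₐ[R] FreeAlgebra R Y :=
  FreeAlgebra.lift R fun i => ∑ j with φ j = some i, FreeAlgebra.ι R j

theorem assocSubst_ι (φ : Y → Option X) (i : X) :
    assocSubst R φ (FreeAlgebra.ι R i) = ∑ j with φ j = some i, FreeAlgebra.ι R j :=
  FreeAlgebra.lift_ι_apply _ _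

theorem assocSubst_wordSum [Fintype X] (φ : Y → Option X) {e : ℕ} (g : (Fin e → X) → R) :
    assocSubst R φ (wordSum R X e g) = wordSum R Y e (wordPull φ g) := by
  induction e with
  | zero =>
    rw [wordSum_zero, wordSum_zero, AlgHom.commutes,
      wordPull_of_forall_eq_some g (v := Fin.elim0) (fun p => p.elim0)]
  | succ e ih =>
    have hj (j : Y) : FreeAlgebra.ι R j * wordSum R Y e (fun w => wordPull φ g (Fin.cons j w)) =
        ∑ i, (if φ j = some i then FreeAlgebra.ι R j else 0) *
          wordSum R Y e (wordPull φ fun v => g (Fin.cons i v)) := by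
      rw [wordPull_cons]
      rcases φ j with _ | i <;> simp
    simp only [wordSum_succ, map_sum, map_mul, assocSubst_ι, ih, Finset.sum_mul,
      Finset.sum_filter, hj]
    exact Finset.sum_comm

end Words

section LieElements

variable {k : Type*} [Field k] {m n : ℕ}

/-! ### The Dynkin map -/

section Dynkin

attribute [local instance 100] LieRing.ofAssociativeRing

theorem toAssoc_mem_span_range_ι_pow {e : ℕ} {a : FreeLieAlgebra k (Fin n)}
    (ha : a ∈ lieHomog k n e) :
    toAssoc k n a ∈ Submodule.span k (Set.range (FreeAlgebra.ι k)) ^ e := by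
  induction ha using Submodule.span_induction with
  | mem a ha =>
    induction ha with
    | gen i =>
      rw [toAssoc, FreeLieAlgebra.lift_of_apply, pow_one]
      exact Submodule.subset_span ⟨i, rfl⟩
    | @brk p q a b _ _ iha ihb =>
      rw [LieHom.map_lie, LieRing.of_associative_ring_bracket]
      refine sub_mem ?_ ?_
      · rw [pow_add]
        exact Submodule.mul_mem_mul iha ihb
      · rw [add_comm, pow_add]
        exact Submodule.mul_mem_mul ihb iha
  | zero => simp
  | add a b _ _ iha ihb => rw [map_add]; exact add_mem iha ihb
  | smul c a _ iha => rw [map_smul]; exact Submodule.smul_mem _ c iha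

/-- The substitution `x_i ↦ ∑_{φ(j) = i} x_j` on free Lie algebras. -/
def lieSubst (φ : Fin m → Option (Fin n)) :
    FreeLieAlgebra k (Fin n) →ₗ⁅k⁆ FreeLieAlgebra k (Fin m) :=
  FreeLieAlgebra.lift k fun i => (fiberSum k φ i : FreeLieAlgebra k (Fin m))

theorem lieSubst_of (φ : Fin m → Option (Fin n)) (i : Fin n) :
    lieSubst φ (FreeLieAlgebra.of k i) = ∑ j with φ j = some i, FreeLieAlgebra.of k j := by
  rw [lieSubst, FreeLieAlgebra.lift_of_apply, fiberSum]

theorem toAssoc_lieSubst (φ : Fin m → Option (Fin n)) (a : FreeLieAlgebra k (Fin n)) :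
    toAssoc k m (lieSubst φ a) = assocSubst k φ (toAssoc k n a) := by
  have h : (toAssoc k m).comp (lieSubst φ) = (assocSubst k φ).toLieHom.comp (toAssoc k n) :=
    FreeLieAlgebra.hom_ext fun i => by simp [toAssoc, lieSubst_of, assocSubst_ι]
  exact LieHom.congr_fun h a

/-- The Dynkin map, which sends the word `x_{w_1} ⋯ x_{w_e}` to the right-nested bracket
`⁅x_{w_1}, ⁅x_{w_2}, …, x_{w_e}⁆⁆` and constants to zero. -/
def dynkin : FreeAlgebra k (Fin n) →ₗ[k] FreeLieAlgebra k (Fin n) :=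
  LinearMap.fst k _ _ ∘ₗ LinearMap.applyₗ ((0, 1) : FreeLieAlgebra k (Fin n) × k) ∘ₗ
    (FreeAlgebra.lift k (genAct (FreeLieAlgebra.of k))).toLinearMap

theorem dynkin_algebraMap (c : k) : dynkin (algebraMap k (FreeAlgebra k (Fin n)) c) = 0 := by
  simp [dynkin, Algebra.algebraMap_eq_smul_one]

theorem lift_genAct_snd (c : Fin n → FreeLieAlgebra k (Fin n)) (b : FreeAlgebra k (Fin n))
    (z : FreeLieAlgebra k (Fin n) × k) :
    (FreeAlgebra.lift k (genAct c) b z).2 = FreeAlgebra.algebraMapInv b * z.2 := by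
  induction b using FreeAlgebra.induction generalizing z with
  | grade0 s => simp [FreeAlgebra.algebraMapInv, Algebra.algebraMap_eq_smul_one]
  | grade1 i => simp [FreeAlgebra.algebraMapInv, genAct]
  | mul a b iha ihb => rw [map_mul, Module.End.mul_apply, iha, ihb, map_mul, mul_assoc]
  | add a b iha ihb =>
    rw [map_add, LinearMap.add_apply, Prod.snd_add, iha, ihb, map_add, add_mul]

theorem dynkin_ι_mul (i : Fin n) (b : FreeAlgebra k (Fin n)) :
    dynkin (FreeAlgebra.ι k i * b) =
      ⁅FreeLieAlgebra.of k i, dynkin b⁆ + FreeAlgebra.algebraMapInv b • FreeLieAlgebra.of k i := by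
  have h := lift_genAct_snd (FreeLieAlgebra.of k) b (0, 1)
  rw [mul_one] at h
  rw [← h]
  simp [dynkin, Module.End.mul_apply, genAct]

theorem algebraMapInv_wordSum_succ {e : ℕ} (g : (Fin (e + 1) → Fin n) → k) :
    FreeAlgebra.algebraMapInv (wordSum k (Fin n) (e + 1) g) = 0 := by
  simp [wordSum_succ, FreeAlgebra.algebraMapInv]

theorem dynkin_wordSum_one (g : (Fin 1 → Fin n) → k) :
    dynkin (wordSum k (Fin n) 1 g) = ∑ i, g (fun _ => i) • FreeLieAlgebra.of k i := by
  rw [wordSum_succ, map_sum]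
  refine Finset.sum_congr rfl fun i _ => ?_
  rw [dynkin_ι_mul, wordSum_zero, dynkin_algebraMap, lie_zero, zero_add,
    FreeAlgebra.algebraMap_leftInverse]
  exact congrArg (g · • _) (funext fun p => Fin.fin_one_eq_zero p ▸ rfl)

theorem dynkin_wordSum_mem {e : ℕ} (g : (Fin e → Fin n) → k) :
    dynkin (wordSum k (Fin n) e g) ∈ lieHomog k n e := by
  induction e with
  | zero => rw [wordSum_zero, dynkin_algebraMap]; exact zero_mem _
  | succ e ih =>
    rw [wordSum_succ, map_sum]
    refine sum_mem fun i _ => ?_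
    rw [dynkin_ι_mul]
    refine add_mem ?_ ?_
    · exact (congrArg (lieHomog k n) (add_comm 1 e)).le
        (lie_mem_lieHomog (IsLieWord.gen i).mem (ih _))
    · cases e with
      | zero => exact Submodule.smul_mem _ _ (IsLieWord.gen i).mem
      | succ e => rw [algebraMapInv_wordSum_succ, zero_smul]; exact zero_mem _

theorem dynkin_assocSubst_wordSum (φ : Fin m → Option (Fin n)) {e : ℕ} (g : (Fin e → Fin n) → k) :
    dynkin (assocSubst k φ (wordSum k (Fin n) e g)) =
      lieSubst φ (dynkin (wordSum k (Fin n) e g)) := by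
  have algebraMapInv_assocSubst (b : FreeAlgebra k (Fin n)) :
      FreeAlgebra.algebraMapInv (assocSubst k φ b) = FreeAlgebra.algebraMapInv b := by
    refine DFunLike.congr_fun (f := FreeAlgebra.algebraMapInv.comp (assocSubst k φ)) ?_ b
    exact FreeAlgebra.hom_ext (funext fun i => by simp [assocSubst_ι, FreeAlgebra.algebraMapInv])
  induction e with
  | zero => simp only [wordSum_zero, AlgHom.commutes, dynkin_algebraMap, map_zero]
  | succ e ih =>
    simp only [wordSum_succ, map_sum, map_mul, assocSubst_ι, Finset.sum_mul, dynkin_ι_mul, ih,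
      algebraMapInv_assocSubst, map_add, LieHom.map_lie, map_smul, lieSubst_of, sum_lie,
      Finset.smul_sum, Finset.sum_add_distrib]

theorem dynkin_toAssoc {e : ℕ} {a : FreeLieAlgebra k (Fin n)} (ha : a ∈ lieHomog k n e) :
    dynkin (toAssoc k n a) = (e : k) • a := by
  have h : ((FreeAlgebra.lift k (genAct (FreeLieAlgebra.of k))).toLieHom).comp (toAssoc k n) =
      FreeLieAlgebra.lift k (genAct (FreeLieAlgebra.of k)) :=
    FreeLieAlgebra.hom_ext fun i => by simp [toAssoc]
  rw [← freeDer_euler ha]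
  exact congrArg Prod.fst (LinearMap.congr_fun (LieHom.congr_fun h a) (0, 1))

end Dynkin

/-! ### Tuples of Lie elements as functions of words -/

/-- The differential on functions of words with values in a ring: the alternating sum of the
pullbacks along the cofaces, as in `d`. -/
def wordD (R α : Type*) [CommRing R] (n : ℕ) : ((α → Fin n) → R) →ₗ[R] (α → Fin (n + 1)) → R :=
  ∑ i ∈ Finset.range (n + 2), (-1 : R) ^ i • wordPull (coface n i)

theorem wordD_apply {R α : Type*} [CommRing R] (g : (α → Fin n) → R) (w : α → Fin (n + 1)) :
    wordD R α n g w = ∑ i ∈ Finset.range (n + 2), (-1) ^ i * wordPull (coface n i) g w := by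
  simp [wordD]

/-- The pullback of tuples of Lie elements along a partially defined map of the generators; it is
the homogeneous counterpart of `tuplePull`. -/
def liePull (φ : Fin m → Option (Fin n)) :
    (Fin n → FreeLieAlgebra k (Fin n)) →ₗ[k] Fin m → FreeLieAlgebra k (Fin m) :=
  LinearMap.pi fun j =>
    (φ j).elim 0 fun i => (lieSubst (k := k) φ : _ →ₗ[k] _) ∘ₗ LinearMap.proj i

theorem liePull_apply (φ : Fin m → Option (Fin n)) (u : Fin n → FreeLieAlgebra k (Fin n))
    (j : Fin m) : liePull φ u j = (φ j).elim 0 fun i => lieSubst φ (u i) := by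
  simp only [liePull, LinearMap.pi_apply]
  rcases φ j with _ | i <;> rfl

variable (k) in
/-- The differential on tuples of Lie elements: the alternating sum of the pullbacks along the
cofaces, as in `d`. -/
def lieD (n : ℕ) :
    (Fin n → FreeLieAlgebra k (Fin n)) →ₗ[k] Fin (n + 1) → FreeLieAlgebra k (Fin (n + 1)) :=
  ∑ i ∈ Finset.range (n + 2), (-1 : k) ^ i • liePull (coface n i)

section Coefficients

attribute [local instance 100] LieRing.ofAssociativeRing

variable (k n) in
/-- The coefficients of a tuple `u` of Lie elements of degree `e`: the value at the word
`w_0 w_1 ⋯ w_e` is the coefficient of `w_1 ⋯ w_e` in the component `u_{w_0}`. -/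
def tupleCoeff (e : ℕ) :
    (Fin n → FreeLieAlgebra k (Fin n)) →ₗ[k] (Fin (e + 1) → Fin n) → k :=
  LinearMap.pi fun w => LinearMap.proj (Fin.tail w) ∘ₗ wordCoeff k (Fin n) e ∘ₗ
    (toAssoc k n : _ →ₗ[k] _) ∘ₗ LinearMap.proj (w 0)

theorem tupleCoeff_cons {e : ℕ} (u : Fin n → FreeLieAlgebra k (Fin n)) (i : Fin n) :
    (fun w => tupleCoeff k n e u (Fin.cons i w)) = wordCoeff k (Fin n) e (toAssoc k n (u i)) :=
  rfl

theorem tupleCoeff_liePull (φ : Fin m → Option (Fin n)) {e : ℕ}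
    {u : Fin n → FreeLieAlgebra k (Fin n)} (hu : ∀ i, u i ∈ lieHomog k n e) :
    tupleCoeff k m e (liePull φ u) = wordPull φ (tupleCoeff k n e u) := by
  have hcons (j : Fin m) : (fun w => tupleCoeff k m e (liePull φ u) (Fin.cons j w)) =
      fun w => wordPull φ (tupleCoeff k n e u) (Fin.cons j w) := by
    rw [tupleCoeff_cons, wordPull_cons, liePull_apply]
    rcases φ j with _ | i
    · simp
    · rw [Option.elim_some, Option.elim_some, tupleCoeff_cons, toAssoc_lieSubst,
        ← wordSum_wordCoeff (toAssoc_mem_span_range_ι_pow (hu i)), assocSubst_wordSum,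
        wordCoeff_wordSum, wordCoeff_wordSum]
  funext w
  rw [← Fin.cons_self_tail w]
  exact congrFun (hcons (w 0)) (Fin.tail w)

theorem tupleCoeff_lieD {e : ℕ} {u : Fin n → FreeLieAlgebra k (Fin n)}
    (hu : ∀ i, u i ∈ lieHomog k n e) :
    tupleCoeff k (n + 1) e (lieD k n u) = wordD k (Fin (e + 1)) n (tupleCoeff k n e u) := by
  simp only [lieD, wordD, LinearMap.sum_apply, LinearMap.smul_apply, map_sum, map_smul,
    tupleCoeff_liePull _ hu]

variable (k n) in
/-- The tuple of Lie elements of degree `e` obtained from a function of words by applying the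
Dynkin map; the factor `1 / e` makes it a left inverse of `tupleCoeff k n e` on homogeneous
tuples. -/
def dynkinTuple (e : ℕ) :
    ((Fin (e + 1) → Fin n) → k) →ₗ[k] Fin n → FreeLieAlgebra k (Fin n) :=
  LinearMap.pi fun i =>
    (e : k)⁻¹ • dynkin ∘ₗ wordSum k (Fin n) e ∘ₗ LinearMap.funLeft k k fun w => Fin.cons i w

theorem dynkinTuple_apply {e : ℕ} (g : (Fin (e + 1) → Fin n) → k) (i : Fin n) :
    dynkinTuple k n e g i =
      (e : k)⁻¹ • dynkin (wordSum k (Fin n) e fun w => g (Fin.cons i w)) := rfl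

theorem dynkinTuple_mem {e : ℕ} (g : (Fin (e + 1) → Fin n) → k) (i : Fin n) :
    dynkinTuple k n e g i ∈ lieHomog k n e :=
  Submodule.smul_mem _ _ (dynkin_wordSum_mem _)

theorem dynkinTuple_tupleCoeff [CharZero k] {e : ℕ} (he : e ≠ 0)
    {u : Fin n → FreeLieAlgebra k (Fin n)} (hu : ∀ i, u i ∈ lieHomog k n e) :
    dynkinTuple k n e (tupleCoeff k n e u) = u := by
  funext i
  rw [dynkinTuple_apply, tupleCoeff_cons,
    wordSum_wordCoeff (toAssoc_mem_span_range_ι_pow (hu i)), dynkin_toAssoc (hu i),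
    inv_smul_smul₀ (Nat.cast_ne_zero.2 he)]

theorem liePull_dynkinTuple (φ : Fin m → Option (Fin n)) {e : ℕ}
    (g : (Fin (e + 1) → Fin n) → k) :
    liePull φ (dynkinTuple k n e g) = dynkinTuple k m e (wordPull φ g) := by
  funext j
  rw [liePull_apply, dynkinTuple_apply, wordPull_cons]
  rcases φ j with _ | i
  · simp
  · simp only [Option.elim_some, dynkinTuple_apply, map_smul, ← dynkin_assocSubst_wordSum,
      assocSubst_wordSum]

theorem lieD_dynkinTuple {e : ℕ} (g : (Fin (e + 1) → Fin n) → k) :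
    lieD k n (dynkinTuple k n e g) = dynkinTuple k (n + 1) e (wordD k (Fin (e + 1)) n g) := by
  simp only [lieD, wordD, LinearMap.sum_apply, LinearMap.smul_apply, map_sum, map_smul,
    liePull_dynkinTuple]

theorem freeCoeff_dynkinTuple {e : ℕ} {g : (Fin (e + 1) → Fin n) → k} {i : Fin n}
    (hg : g (fun _ => i) = 0) : freeCoeff k i (dynkinTuple k n e g i) = 0 := by
  rcases eq_or_ne e 1 with rfl | he
  · have hcons : (Fin.cons i fun _ => i : Fin 2 → Fin n) = fun _ => i :=
      Fin.cons_self_tail fun _ => i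
    simp [dynkinTuple_apply, dynkin_wordSum_one, freeCoeff_of, hcons, hg]
  · exact freeCoeff_eq_zero i he (dynkinTuple_mem g i)

end Coefficients

end LieElements

/-! ### Chains of subsets -/

section Chains

variable {α : Type*} [DecidableEq α] {n : ℕ}

/-- The word with `n + 1` letters attached to a chain `S_0 ⊆ ⋯ ⊆ S_{n-1}` of sets of positions:
the letter at `p` is the number of members of the chain which do not contain `p`, so that the first
`i + 1` letters occupy the positions in `S_i`. -/
def chainWord (S : Fin n → Finset α) (p : α) : Fin (n + 1) :=
  ⟨(Finset.univ.filter fun i => p ∉ S i).card, Nat.lt_succ_iff.2 (card_finset_fin_le _)⟩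

theorem lt_chainWord_iff {S : Fin n → Finset α} (hS : Monotone S) {i : Fin n} {p : α} :
    i.1 < (chainWord S p).1 ↔ p ∉ S i := by
  constructor
  · refine fun h hp => h.not_ge ?_
    rw [chainWord, ← Fin.card_Iio i]
    dsimp only
    refine Finset.card_le_card fun j hj => Finset.mem_Iio.2 ?_
    by_contra! hij
    exact (Finset.mem_filter.1 hj).2 (hS hij hp)
  · intro hp
    rw [chainWord, ← Nat.succ_le_iff, Nat.succ_eq_add_one, ← Fin.card_Iic i]
    dsimp only
    refine Finset.card_le_card fun j hj => ?_
    simpa using fun hj' => hp (hS (Finset.mem_Iic.1 hj) hj')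

theorem exists_chainWord_eq [Finite α] (w : α → Fin (n + 1)) :
    ∃ S : Fin n → Finset α, Monotone S ∧ chainWord S = w := by
  have := Fintype.ofFinite α
  refine ⟨fun i => Finset.univ.filter fun p => w p ≤ i.castSucc, fun i j hij => ?_,
    funext fun p => Fin.ext ?_⟩
  · exact Finset.monotone_filter_right _ fun p _ hp => hp.trans (Fin.castSucc_le_castSucc_iff.2 hij)
  · simp [chainWord, Fin.lt_def, Fin.card_filter_val_lt, Fin.is_le]

theorem coface_succ_chainWord {S : Fin (n + 1) → Finset α} (hS : Monotone S) (j : Fin (n + 1))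
    (p : α) : coface (n + 1) (j.1 + 1) (chainWord S p) = some (chainWord (j.removeNth S) p) := by
  have hval : (chainWord S p).1 =
      (if p ∉ S j then 1 else 0) + (chainWord (j.removeNth S) p).1 := by
    simp only [chainWord, Finset.card_filter]
    exact Fin.sum_univ_succAbove _ j
  have hlt := lt_chainWord_iff hS (i := j) (p := p)
  have hle := j.is_le
  rw [coface]
  split_ifs at hval with hp <;> split_ifs <;> simp_all [Fin.ext_iff] <;> omega

theorem chainWord_eq_zero_iff {S : Fin (n + 1) → Finset α} (hS : Monotone S) {p : α} :
    chainWord S p = 0 ↔ p ∈ S 0 := by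
  rw [← not_iff_not, ← lt_chainWord_iff hS, ← Ne, ← Fin.pos_iff_ne_zero]
  rfl

theorem chainWord_eq_last_iff {S : Fin (n + 1) → Finset α} (hS : Monotone S) {p : α} :
    chainWord S p = Fin.last (n + 1) ↔ p ∉ S (Fin.last n) := by
  rw [← lt_chainWord_iff hS, Fin.val_last, ← Nat.succ_le_iff, Nat.succ_eq_add_one,
    ← Fin.last_le_iff, Fin.le_def, Fin.val_last]

variable [Fintype α] {R : Type*} [CommRing R]

theorem wordD_chainWord (g : (α → Fin (n + 1)) → R) {S : Fin (n + 1) → Finset α}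
    (hS : Monotone S) :
    wordD R α (n + 1) g (chainWord S) =
      (if S 0 = ∅ then g (chainWord (Fin.removeNth 0 S)) else 0) +
      ∑ j : Fin (n + 1), (-1) ^ (j.1 + 1) * g (chainWord (j.removeNth S)) +
      (-1) ^ (n + 2) *
        if S (Fin.last n) = Finset.univ then g (chainWord ((Fin.last n).removeNth S)) else 0 := by
  have first : wordPull (coface (n + 1) 0) g (chainWord S) =
      if S 0 = ∅ then g (chainWord (Fin.removeNth 0 S)) else 0 := by
    split_ifs with h
    · refine wordPull_of_forall_eq_some g fun p => ?_
      rw [← coface_succ_chainWord hS 0 p]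
      have hp : chainWord S p ≠ 0 := by simp [chainWord_eq_zero_iff hS, h]
      have := Fin.val_ne_of_ne hp
      simp_all [coface]
    · obtain ⟨p, hp⟩ := Finset.nonempty_iff_ne_empty.2 h
      refine wordPull_of_eq_none g (p := p) ?_
      rw [coface_first, (chainWord_eq_zero_iff hS).2 hp]
      rfl
  have last : wordPull (coface (n + 1) (n + 2)) g (chainWord S) =
      if S (Fin.last n) = Finset.univ then g (chainWord ((Fin.last n).removeNth S)) else 0 := by
    split_ifs with h
    · refine wordPull_of_forall_eq_some g fun p => ?_
      rw [← coface_succ_chainWord hS (Fin.last n) p]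
      have hp : chainWord S p ≠ Fin.last (n + 1) := by simp [chainWord_eq_last_iff hS, h]
      have := Fin.val_lt_last hp
      simp_all [coface]
    · obtain ⟨p, hp⟩ := not_forall.1 (mt Finset.eq_univ_iff_forall.2 h)
      refine wordPull_of_eq_none g (p := p) ?_
      rw [coface_last, (chainWord_eq_last_iff hS).2 hp, dropLast, Fin.lastCases_last]
  rw [wordD_apply, Finset.sum_range_succ, Finset.sum_range_succ', first, last, pow_zero, one_mul,
    ← Fin.sum_univ_eq_sum_range fun i => (-1) ^ (i + 1) * wordPull (coface (n + 1) (i + 1)) g _]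
  simp only [wordPull_of_forall_eq_some g (coface_succ_chainWord hS _)]
  ring

end Chains

/-! ### One-dimensional cocycles on the poset of nonempty proper subsets -/

section Flags

variable {α : Type*} [DecidableEq α] [Fintype α] {M : Type*} [AddCommGroup M]

/-- A one-dimensional cocycle on the poset of nonempty proper subsets of a finite set, as a
function on the pairs `S ⊆ T`. -/
def IsFlagCocycle (Φ : Finset α → Finset α → M) : Prop :=
  ∀ ⦃S T U⦄, S.Nonempty → S ⊆ T → T ⊆ U → U ≠ Finset.univ → Φ S U = Φ S T + Φ T U

/-- A one-dimensional coboundary on the poset of nonempty proper subsets of a finite set. -/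
def IsFlagCoboundary (Φ : Finset α → Finset α → M) : Prop :=
  ∃ G : Finset α → M, ∀ ⦃S T⦄, S.Nonempty → S ⊆ T → T ≠ Finset.univ → Φ S T = G S - G T

/-- The values of `Φ` along the zigzag `S ⊆ S ∪ {p} ⊇ {p}`, which contract the poset of those `S`
for which `S ∪ {p}` is proper. -/
def conePotential (p : α) (Φ : Finset α → Finset α → M) (S : Finset α) : M :=
  Φ S (insert p S) - Φ {p} (insert p S)

theorem eq_compl_singleton {p : α} {S : Finset α} (hS : S ≠ Finset.univ)
    (hpS : insert p S = Finset.univ) : S = {p}ᶜ := by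
  have hp : p ∉ S := fun hp => hS (Finset.insert_eq_of_mem hp ▸ hpS)
  rw [← Finset.erase_insert hp, hpS, Finset.compl_singleton]

variable {Φ : Finset α → Finset α → M}

theorem IsFlagCocycle.eq_conePotential_sub (h : IsFlagCocycle Φ) {p : α} {S T : Finset α}
    (hS : S.Nonempty) (hST : S ⊆ T) (hT : insert p T ≠ Finset.univ) :
    Φ S T = conePotential p Φ S - conePotential p Φ T := by
  have hp : {p} ⊆ insert p S := by simp
  have hins : insert p S ⊆ insert p T := Finset.insert_subset_insert p hST
  have h₁ := h hS hST (Finset.subset_insert p T) hT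
  have h₂ := h hS (Finset.subset_insert p S) hins hT
  have h₃ := h (Finset.singleton_nonempty p) hp hins hT
  rw [conePotential, conePotential, h₃, ← add_sub_cancel_right (Φ S T), ← h₁, h₂]
  abel

theorem IsFlagCocycle.conePotential_sub_eq (h : IsFlagCocycle Φ) {p x : α} {T : Finset α}
    (hT : T ⊆ {p}ᶜ) (hpT : insert p T ≠ Finset.univ) (hx : x ∈ T) :
    conePotential p Φ {x} - Φ {x} {p}ᶜ = conePotential p Φ T - Φ T {p}ᶜ := by
  have hxT : {x} ⊆ T := Finset.singleton_subset_iff.2 hx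
  have hcompl : ({p}ᶜ : Finset α) ≠ Finset.univ := by simp
  rw [h (Finset.singleton_nonempty x) hxT hT hcompl,
    h.eq_conePotential_sub (Finset.singleton_nonempty x) hxT hpT]
  abel

/-- The cone at `p` fails to reach only the set `{p}ᶜ`, where the value `c` of a potential is
forced by every `{x} ⊆ {p}ᶜ`. -/
theorem IsFlagCocycle.isFlagCoboundary_of_forall (h : IsFlagCocycle Φ) (p : α) {c : M}
    (hc : ∀ x, x ≠ p → conePotential p Φ {x} - Φ {x} {p}ᶜ = c) : IsFlagCoboundary Φ := by
  refine ⟨fun S => if S = {p}ᶜ then c else conePotential p Φ S, fun S T hS hST hT => ?_⟩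
  dsimp only
  by_cases hTp : T = {p}ᶜ
  · subst hTp
    by_cases hSp : S = {p}ᶜ
    · rw [if_pos hSp, if_pos rfl, sub_self, hSp]
      simpa using h (hSp ▸ hS) subset_rfl subset_rfl hT
    · obtain ⟨x, hx⟩ := hS
      have hxp : x ≠ p := by simpa using hST hx
      have hpS : insert p S ≠ Finset.univ := fun hpS =>
        hSp (eq_compl_singleton (fun hS' => hT (Finset.univ_subset_iff.1 (hS' ▸ hST))) hpS)
      rw [if_neg hSp, if_pos rfl, ← hc x hxp, h.conePotential_sub_eq hST hpS hx, sub_sub_cancel]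
  · have hpT : insert p T ≠ Finset.univ := fun hpT => hTp (eq_compl_singleton hT hpT)
    have hSp : S ≠ {p}ᶜ := by
      rintro rfl
      refine hpT (Finset.univ_subset_iff.1 ?_)
      rw [← Finset.insert_compl_self p]
      exact Finset.insert_subset_insert p hST
    rw [if_neg hSp, if_neg hTp, h.eq_conePotential_sub hS hST hpT]

omit [DecidableEq α] in
theorem IsFlagCocycle.isFlagCoboundary (h : IsFlagCocycle Φ) (hα : Fintype.card α ≠ 3) :
    IsFlagCoboundary Φ := by
  classical
  rcases isEmpty_or_nonempty α with _ | ⟨⟨p⟩⟩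
  · exact ⟨0, fun S _ ⟨x, _⟩ => isEmptyElim x⟩
  by_cases hq : ∃ q, q ≠ p
  · obtain ⟨q, hq⟩ := hq
    refine h.isFlagCoboundary_of_forall p (c := conePotential p Φ {q} - Φ {q} {p}ᶜ)
      fun x hx => ?_
    rcases eq_or_ne x q with rfl | hxq
    · rfl
    have hT : {x, q} ⊆ ({p}ᶜ : Finset α) := by simp [hx.symm, hq.symm]
    have hpT : insert p {x, q} ≠ (Finset.univ : Finset α) := fun hpT => hα <| by
      rw [← Finset.card_univ, ← hpT, Finset.card_eq_three]
      exact ⟨p, x, q, hx.symm, hq.symm, hxq, rfl⟩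
    rw [h.conePotential_sub_eq hT hpT (by simp), h.conePotential_sub_eq hT hpT (by simp)]
  · exact h.isFlagCoboundary_of_forall p (c := 0) fun x hx => (hq ⟨x, hx⟩).elim

theorem IsFlagCocycle.isFlagCoboundary_of_hexagon {Φ : Finset (Fin 3) → Finset (Fin 3) → M}
    (h : IsFlagCocycle Φ)
    (hexagon : Φ {1} {0, 1} - Φ {0} {0, 1} - Φ {1} {1, 2} =
      Φ {2} {0, 2} - Φ {0} {0, 2} - Φ {2} {1, 2}) : IsFlagCoboundary Φ := by
  have hcompl : ({0}ᶜ : Finset (Fin 3)) = {1, 2} := by decide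
  refine h.isFlagCoboundary_of_forall 0 (c := conePotential 0 Φ {2} - Φ {2} {0}ᶜ) fun x hx => ?_
  fin_cases x
  · exact absurd rfl hx
  · rw [hcompl]
    exact hexagon
  · rfl

end Flags

section FlagWords

variable {α R : Type*} [DecidableEq α] [Fintype α] [CommRing R]

theorem wordD_chainWord_one (g : (α → Fin 1) → R) (S : Finset α) :
    wordD R α 1 g (chainWord ![S]) =
      (if S = ∅ then g 0 else 0) - g 0 + if S = Finset.univ then g 0 else 0 := by
  simp [wordD_chainWord g (S := ![S]) (by simp), Subsingleton.elim _ (0 : α → Fin 1),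
    sub_eq_add_neg]

theorem wordD_chainWord_two (g : (α → Fin 2) → R) {S T : Finset α} (hST : S ⊆ T) :
    wordD R α 2 g (chainWord ![S, T]) =
      (if S = ∅ then g (chainWord ![T]) else 0) - g (chainWord ![T]) + g (chainWord ![S]) -
        if T = Finset.univ then g (chainWord ![S]) else 0 := by
  have h₁ : Fin.removeNth 1 ![S, T] = ![S] := funext (Fin.forall_fin_one.2 rfl)
  simp [wordD_chainWord g (S := ![S, T]) (by simp [hST]), Fin.sum_univ_two, h₁, sub_eq_add_neg,
    neg_ite, pow_succ, add_assoc, add_left_comm]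

theorem wordD_chainWord_three (g : (α → Fin 3) → R) {S T U : Finset α} (hST : S ⊆ T)
    (hTU : T ⊆ U) :
    wordD R α 3 g (chainWord ![S, T, U]) =
      (if S = ∅ then g (chainWord ![T, U]) else 0) - g (chainWord ![T, U]) +
        g (chainWord ![S, U]) - g (chainWord ![S, T]) +
          if U = Finset.univ then g (chainWord ![S, T]) else 0 := by
  have h₁ : Fin.removeNth 1 ![S, T, U] = ![S, U] := funext (Fin.forall_fin_two.2 ⟨rfl, rfl⟩)
  have h₂ : Fin.removeNth 2 ![S, T, U] = ![S, T] := funext (Fin.forall_fin_two.2 ⟨rfl, rfl⟩)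
  simp [wordD_chainWord g (S := ![S, T, U]) (by simp [hST, hTU]), Fin.sum_univ_three, h₁, h₂,
    sub_eq_add_neg, pow_succ, add_assoc, add_left_comm]

omit [Fintype α] in
theorem exists_eq_chainWord_one [Finite α] (w : α → Fin 2) :
    ∃ S : Finset α, w = chainWord ![S] := by
  obtain ⟨S, -, rfl⟩ := exists_chainWord_eq w
  exact ⟨S 0, congrArg chainWord (List.ofFn_injective rfl)⟩

omit [Fintype α] in
theorem exists_eq_chainWord_two [Finite α] (w : α → Fin 3) :
    ∃ S T : Finset α, S ⊆ T ∧ w = chainWord ![S, T] := by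
  obtain ⟨S, hS, rfl⟩ := exists_chainWord_eq w
  exact ⟨S 0, S 1, hS (Fin.zero_le 1), congrArg chainWord (List.ofFn_injective rfl)⟩

theorem apply_chainWord_eq_of_subset {f : (α → Fin 2) → R} (hf : wordD R α 2 f = 0)
    {S T : Finset α} (hS : S.Nonempty) (hST : S ⊆ T) (hT : T ≠ Finset.univ) :
    f (chainWord ![S]) = f (chainWord ![T]) := by
  have hD := wordD_chainWord_two f hST
  rw [hf, Pi.zero_apply, if_neg hS.ne_empty, if_neg hT] at hD
  linear_combination -hD

theorem apply_chainWord_eq_singleton {f : (α → Fin 2) → R} (hf : wordD R α 2 f = 0)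
    (hα : 3 ≤ Fintype.card α) {S : Finset α} (hS : S.Nonempty) (hS' : S ≠ Finset.univ) (p : α) :
    f (chainWord ![S]) = f (chainWord ![{p}]) := by
  obtain ⟨x, hx⟩ := hS
  have hxp : ({x, p} : Finset α) ≠ Finset.univ := fun h => by
    rw [← Finset.card_univ, ← h] at hα
    exact absurd (hα.trans Finset.card_le_two) (by norm_num)
  rw [← apply_chainWord_eq_of_subset hf (Finset.singleton_nonempty x)
      (Finset.singleton_subset_iff.2 hx) hS',
    apply_chainWord_eq_of_subset hf (Finset.singleton_nonempty x) (T := {x, p}) (by simp) hxp,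
    apply_chainWord_eq_of_subset hf (Finset.singleton_nonempty p) (T := {x, p}) (by simp) hxp]

omit [DecidableEq α] in
theorem exists_wordD_one_eq (hα : 3 ≤ Fintype.card α) {f : (α → Fin 2) → R}
    (hf : wordD R α 2 f = 0) : ∃ g, wordD R α 1 g = f := by
  classical
  have : Nonempty α := Fintype.card_pos_iff.1 (by omega)
  let p := Classical.arbitrary α
  have huniv : (Finset.univ : Finset α) ≠ ∅ := Finset.univ_nonempty.ne_empty
  refine ⟨fun _ => -f (chainWord ![{p}]), funext fun w => ?_⟩
  obtain ⟨S, rfl⟩ := exists_eq_chainWord_one w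
  have hD := wordD_chainWord_two f (subset_refl S)
  rw [wordD_chainWord_one]
  rcases eq_or_ne S ∅ with rfl | hS
  · simpa [hf, huniv.symm] using hD
  rcases eq_or_ne S Finset.univ with rfl | hS'
  · simpa [hf, huniv, eq_comm] using hD
  · simp [hS, hS', apply_chainWord_eq_singleton hf hα (Finset.nonempty_iff_ne_empty.2 hS) hS' p]

theorem isFlagCocycle_of_wordD_eq_zero {f : (α → Fin 3) → R} (hf : wordD R α 3 f = 0) :
    IsFlagCocycle fun S T => f (chainWord ![S, T]) := by
  intro S T U hS hST hTU hU
  have hD := wordD_chainWord_three f hST hTU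
  rw [hf, Pi.zero_apply, if_neg hS.ne_empty, if_neg hU] at hD
  linear_combination -hD

omit [Fintype α] in
theorem apply_chainWord_empty_left [Finite α] [Nonempty α] {f : (α → Fin 3) → R}
    (hf : wordD R α 3 f = 0) (hconst : f (fun _ => 2) = 0) (T : Finset α) :
    f (chainWord ![∅, T]) = 0 := by
  have := Fintype.ofFinite α
  have hempty : chainWord ![∅, ∅] = fun _ : α => 2 := funext fun p =>
    (chainWord_eq_last_iff (S := ![∅, ∅]) (by simp)).2 (Finset.notMem_empty p)
  have hD := wordD_chainWord_three f (subset_refl ∅) (Finset.empty_subset T)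
  by_cases hT : T = Finset.univ
  · simpa [hf, hT, eq_comm] using hD
  · simpa [hf, hT, hempty, hconst, eq_comm] using hD

theorem apply_chainWord_univ_right [Nonempty α] {f : (α → Fin 3) → R} (hf : wordD R α 3 f = 0)
    (hconst : f (fun _ => 0) = 0) (S : Finset α) : f (chainWord ![S, Finset.univ]) = 0 := by
  have huniv : chainWord ![Finset.univ, Finset.univ] = fun _ : α => 0 := funext fun p =>
    (chainWord_eq_zero_iff (S := ![Finset.univ, Finset.univ]) (by simp)).2 (Finset.mem_univ p)
  have hD := wordD_chainWord_three f (Finset.subset_univ S) (subset_refl Finset.univ)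
  by_cases hS : S = ∅
  · simpa [hf, hS, huniv, hconst, eq_comm] using hD
  · simpa [hf, hS, huniv, hconst, eq_comm] using hD

theorem exists_wordD_two_eq_of_isFlagCoboundary [Nonempty α] {f : (α → Fin 3) → R}
    (hf : wordD R α 3 f = 0) (hconst : ∀ i, f (fun _ => i) = 0)
    (hΦ : IsFlagCoboundary fun S T => f (chainWord ![S, T])) :
    ∃ g, (∀ i, g (fun _ => i) = 0) ∧ wordD R α 2 g = f := by
  obtain ⟨G, hG⟩ := hΦ
  let g (w : α → Fin 2) : R :=
    let S : Finset α := {p | w p = 0}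
    if S.Nonempty ∧ S ≠ Finset.univ then G S else 0
  have hg (S : Finset α) :
      g (chainWord ![S]) = if S.Nonempty ∧ S ≠ Finset.univ then G S else 0 := by
    have hS : ({p | chainWord ![S] p = 0} : Finset α) = S := by
      ext p
      simp [chainWord_eq_zero_iff (S := ![S]) (by simp)]
    simp only [g, hS]
  refine ⟨g, ?_, funext fun w => ?_⟩
  · simp [Fin.forall_fin_two, g]
  obtain ⟨S, T, hST, rfl⟩ := exists_eq_chainWord_two w
  rw [wordD_chainWord_two g hST, hg, hg]
  rcases S.eq_empty_or_nonempty with rfl | hS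
  · simp [apply_chainWord_empty_left hf (hconst 2)]
  rcases eq_or_ne T Finset.univ with rfl | hT
  · simp [hS.ne_empty, apply_chainWord_univ_right hf (hconst 0)]
  · have hS' : S ≠ Finset.univ := fun h => hT (Finset.univ_subset_iff.1 (h ▸ hST))
    simp [hS, hT, hS', hS.ne_empty, hS.mono hST, hG hS hST hT, neg_add_eq_sub]

omit [DecidableEq α] in
theorem exists_wordD_two_eq [Nonempty α] (hα : Fintype.card α ≠ 3) {f : (α → Fin 3) → R}
    (hf : wordD R α 3 f = 0) (hconst : ∀ i, f (fun _ => i) = 0) :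
    ∃ g, (∀ i, g (fun _ => i) = 0) ∧ wordD R α 2 g = f := by
  classical
  exact exists_wordD_two_eq_of_isFlagCoboundary hf hconst
    ((isFlagCocycle_of_wordD_eq_zero hf).isFlagCoboundary hα)

end FlagWords

/-! ### The alternating sum over permutations -/

section AltSum

variable {R : Type*} [CommRing R]

/-- The alternating sum of the values of a function at the words in which every letter occurs
exactly once. -/
def altSum (R α : Type*) [CommRing R] [Fintype α] [DecidableEq α] : ((α → α) → R) →ₗ[R] R :=
  ∑ σ : Equiv.Perm α, ((σ.sign : ℤ) : R) • LinearMap.proj (σ : α → α)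

section

variable {α : Type*} [Fintype α] [DecidableEq α]

theorem altSum_apply (F : (α → α) → R) :
    altSum R α F = ∑ σ : Equiv.Perm α, ((σ.sign : ℤ) : R) * F σ := by
  simp [altSum]

theorem altSum_eq_zero_of_comp_swap {F : (α → α) → R} {a b : α} (hab : a ≠ b)
    (hF : ∀ w, F (Equiv.swap a b ∘ w) = F w) : altSum R α F = 0 := by
  rw [altSum_apply]
  refine Finset.sum_involution (fun σ _ => Equiv.swap a b * σ) (fun σ _ => ?_) (fun σ _ _ => ?_)
    (fun _ _ => Finset.mem_univ _) (fun σ _ => Equiv.swap_mul_self_mul a b σ)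
  · rw [Equiv.Perm.sign_mul, Equiv.Perm.sign_swap hab, Equiv.Perm.coe_mul, hF]
    simp
  · simpa using hab

theorem altSum_wordPull_eq_zero {X : Type*} {φ : α → Option X} (g : (α → X) → R) {j : α}
    (hj : φ j = none) : altSum R α (wordPull φ g) = 0 := by
  rw [altSum_apply]
  refine Finset.sum_eq_zero fun σ _ => ?_
  rw [wordPull_of_eq_none g (p := σ.symm j) (by rwa [σ.apply_symm_apply]), mul_zero]

end

theorem altSum_wordPull_merge {n : ℕ} (i : Fin n) (g : (Fin (n + 1) → Fin n) → R) :
    altSum R (Fin (n + 1)) (wordPull (merge i) g) = 0 := by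
  have hmerge : merge i ∘ Equiv.swap i.castSucc i.succ = merge i := by
    funext j
    rcases eq_or_ne j i.castSucc with rfl | hj
    · simp [merge]
    rcases eq_or_ne j i.succ with rfl | hj'
    · simp [merge]
    · rw [Function.comp_apply, Equiv.swap_apply_of_ne_of_ne hj hj']
  refine altSum_eq_zero_of_comp_swap i.castSucc_lt_succ.ne fun w => ?_
  conv_rhs => rw [← hmerge]
  rfl

theorem altSum_wordD {n : ℕ} (g : (Fin (n + 1) → Fin n) → R) :
    altSum R (Fin (n + 1)) (wordD R (Fin (n + 1)) n g) = 0 := by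
  rw [wordD, LinearMap.sum_apply, map_sum]
  refine Finset.sum_eq_zero fun i hi => ?_
  rw [LinearMap.smul_apply, map_smul]
  convert smul_zero _
  rcases i with _ | i
  · exact altSum_wordPull_eq_zero g (j := 0) (by rw [coface_first]; rfl)
  rcases (Nat.lt_succ_iff.1 (Nat.succ_lt_succ_iff.1 (Finset.mem_range.1 hi))).eq_or_lt with
    rfl | hi
  · exact altSum_wordPull_eq_zero g (j := Fin.last _)
      (by rw [coface_last, dropLast, Fin.lastCases_last])
  · rw [show i = (⟨i, hi⟩ : Fin n).1 from rfl, coface_merge]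
    exact altSum_wordPull_merge _ g

theorem altSum_fin_three (F : (Fin 3 → Fin 3) → R) :
    altSum R (Fin 3) F =
      F (chainWord ![{0}, {0, 1}]) - F (chainWord ![{1}, {0, 1}]) + F (chainWord ![{1}, {1, 2}]) -
        F (chainWord ![{2}, {1, 2}]) + F (chainWord ![{2}, {0, 2}]) -
          F (chainWord ![{0}, {0, 2}]) := by
  let s₀ : Equiv.Perm (Fin 3) := Equiv.swap 0 1
  let s₁ : Equiv.Perm (Fin 3) := Equiv.swap 1 2
  let s₂ : Equiv.Perm (Fin 3) := Equiv.swap 0 2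
  have huniv : Finset.univ = {1, s₀, s₁ * s₀, s₂, s₀ * s₁, s₁} := by decide
  have h₁ : chainWord ![{0}, {0, 1}] = ⇑(1 : Equiv.Perm (Fin 3)) := by decide
  have h₂ : chainWord ![{1}, {0, 1}] = ⇑s₀ := by decide
  have h₃ : chainWord ![{1}, {1, 2}] = ⇑(s₁ * s₀) := by decide
  have h₄ : chainWord ![{2}, {1, 2}] = ⇑s₂ := by decide
  have h₅ : chainWord ![{2}, {0, 2}] = ⇑(s₀ * s₁) := by decide
  have h₆ : chainWord ![{0}, {0, 2}] = ⇑s₁ := by decide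
  rw [altSum_apply, huniv, h₁, h₂, h₃, h₄, h₅, h₆]
  iterate 5 rw [Finset.sum_insert (by decide)]
  have hs₀ : s₀.sign = -1 := by decide
  have hs₁ : s₁.sign = -1 := by decide
  have hs₂ : s₂.sign = -1 := by decide
  simp [hs₀, hs₁, hs₂, sub_eq_add_neg, add_assoc]

theorem exists_wordD_two_eq_of_altSum_eq_zero {f : (Fin 3 → Fin 3) → R}
    (hf : wordD R (Fin 3) 3 f = 0) (hconst : ∀ i, f (fun _ => i) = 0)
    (halt : altSum R (Fin 3) f = 0) :
    ∃ g, (∀ i, g (fun _ => i) = 0) ∧ wordD R (Fin 3) 2 g = f := by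
  refine exists_wordD_two_eq_of_isFlagCoboundary hf hconst
    ((isFlagCocycle_of_wordD_eq_zero hf).isFlagCoboundary_of_hexagon ?_)
  rw [altSum_fin_three] at halt
  linear_combination -halt

end AltSum

section Cohomology

variable {k : Type*} [Field k] {m n : ℕ}

/-! ### Homogeneous components of tangential derivations -/

theorem eq_zero_of_mem_lieHomog_one_letter {e : ℕ} (he : 2 ≤ e) {a : FreeLieAlgebra k (Fin 1)}
    (ha : a ∈ lieHomog k 1 e) : a = 0 := by
  induction e, he using Nat.le_induction generalizing a with
  | base =>
    obtain ⟨b, hb, rfl⟩ := lieHomog_succ le_rfl ha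
    refine Finset.sum_eq_zero fun i _ => ?_
    rw [lieHomog_one (hb i), Fin.sum_univ_one, Subsingleton.elim i 0, lie_smul, lie_self, smul_zero]
  | succ e he ih =>
    obtain ⟨b, hb, rfl⟩ := lieHomog_succ (by omega) ha
    exact Finset.sum_eq_zero fun i _ => by rw [ih (hb i), lie_zero]

instance : Subsingleton (normTuple k 1) := by
  refine subsingleton_of_forall_eq 0 fun a => Subtype.ext (funext fun i => CLie.ext fun e => ?_)
  match e with
  | 0 => rw [comp_zero_right, comp_zero_right]
  | 1 =>
    have h : freeCoeff k i ((a.1 i).comp 1) = 0 := a.2 i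
    rw [lieHomog_one ((a.1 i).comp_mem 1), Fin.sum_univ_one, Subsingleton.elim 0 i, h, zero_smul]
    rfl
  | e + 2 => exact eq_zero_of_mem_lieHomog_one_letter (by omega) ((a.1 i).comp_mem _)

section CharZero

variable [CharZero k]

instance : Subsingleton (dert k 1) := (tupleEquiv k 1).symm.toEquiv.subsingleton

/-- The component of degree `e` of the normalized tuple of a tangential derivation. -/
def tupleComp (e : ℕ) : dert k n →ₗ[k] Fin n → FreeLieAlgebra k (Fin n) :=
  (compₗ k n e).compLeft (Fin n) ∘ₗ (normTuple k n).subtype ∘ₗ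
    ((tupleEquiv k n).symm : dert k n →ₗ[k] normTuple k n)

theorem tupleComp_tupleEquiv (e : ℕ) (a : normTuple k n) (i : Fin n) :
    tupleComp e (tupleEquiv k n a) i = (a.1 i).comp e :=
  congrArg (fun b : normTuple k n => (b.1 i).comp e) ((tupleEquiv k n).symm_apply_apply a)

theorem tupleComp_mem (e : ℕ) (u : dert k n) (i : Fin n) : tupleComp e u i ∈ lieHomog k n e :=
  comp_mem _ _

theorem tupleComp_zero_left (u : dert k n) : tupleComp 0 u = 0 :=
  funext fun _ => comp_zero_right _

theorem freeCoeff_tupleComp_one (u : dert k n) (i : Fin n) :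
    freeCoeff k i (tupleComp 1 u i) = 0 :=
  ((tupleEquiv k n).symm u).2 i

theorem tupleComp_ext {u v : dert k n} (h : ∀ e, tupleComp e u = tupleComp e v) : u = v :=
  (tupleEquiv k n).symm.injective <| Subtype.ext <| funext fun i => CLie.ext fun e =>
    congrFun (h e) i

theorem tupleComp_dertPull (φ : Fin m → Option (Fin n)) (e : ℕ) (u : dert k n) :
    tupleComp e (dertPull φ u) = liePull φ (tupleComp e u) := by
  funext j
  rw [dertPull, LinearMap.comp_apply, LinearMap.comp_apply, LinearEquiv.coe_coe,
    tupleComp_tupleEquiv, tuplePull_apply, liePull_apply]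
  rcases φ j with _ | i <;> rfl

theorem tupleComp_d (e : ℕ) (u : dert k n) : tupleComp e (d k n u) = lieD k n (tupleComp e u) := by
  simp only [d_eq_sum, lieD, LinearMap.sum_apply, LinearMap.smul_apply, map_sum, map_smul,
    tupleComp_dertPull]

theorem mem_ker_d_iff {u : dert k n} :
    u ∈ LinearMap.ker (d k n) ↔ ∀ e, lieD k n (tupleComp e u) = 0 := by
  simp only [← tupleComp_d]
  exact ⟨fun h e => by rw [LinearMap.mem_ker.1 h, map_zero],
    fun h => tupleComp_ext fun e => by rw [h, map_zero]⟩

/-- The coefficients of the degree `e` part of a tangential derivation, as a function of words of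
length `e + 1`. -/
def dertCoeff (e : ℕ) : dert k n →ₗ[k] (Fin (e + 1) → Fin n) → k :=
  tupleCoeff k n e ∘ₗ tupleComp e

theorem dertCoeff_d (e : ℕ) (u : dert k n) :
    dertCoeff e (d k n u) = wordD k (Fin (e + 1)) n (dertCoeff e u) := by
  rw [dertCoeff, LinearMap.comp_apply, tupleComp_d, tupleCoeff_lieD (tupleComp_mem e u)]
  rfl

theorem dynkinTuple_dertCoeff {e : ℕ} (he : e ≠ 0) (u : dert k n) :
    dynkinTuple k n e (dertCoeff e u) = tupleComp e u :=
  dynkinTuple_tupleCoeff he (tupleComp_mem e u)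

theorem dertCoeff_const (e : ℕ) (u : dert k n) (i : Fin n) : dertCoeff e u (fun _ => i) = 0 := by
  have h : tupleComp e (dertPull (fun _ : Fin 1 => some i) u) = 0 := by
    rw [Subsingleton.elim (dertPull _ u) 0, map_zero]
  rw [tupleComp_dertPull] at h
  have hpull : wordPull (fun _ : Fin 1 => some i) (dertCoeff e u) = 0 := by
    rw [dertCoeff, LinearMap.comp_apply, ← tupleCoeff_liePull _ (tupleComp_mem e u), h, map_zero]
  have hval := wordPull_of_forall_eq_some (φ := fun _ : Fin 1 => some i) (dertCoeff e u)
    (w := fun _ => 0) (v := fun _ => i) fun _ => rfl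
  rw [← hval, hpull, Pi.zero_apply]

theorem wordD_dertCoeff_of_mem_ker {u : dert k n} (hu : u ∈ LinearMap.ker (d k n)) (e : ℕ) :
    wordD k (Fin (e + 1)) n (dertCoeff e u) = 0 := by
  rw [← dertCoeff_d, LinearMap.mem_ker.1 hu, map_zero]

theorem mem_range_d_of_dertCoeff {u : dert k (n + 1)}
    (h : ∀ e ≠ 0, ∃ g : (Fin (e + 1) → Fin n) → k,
      (∀ i, g (fun _ => i) = 0) ∧ wordD k (Fin (e + 1)) n g = dertCoeff e u) :
    u ∈ LinearMap.range (d k n) := by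
  choose! g hg hgd using h
  let a : normTuple k n :=
    ⟨fun i => CLie.mk (fun e => dynkinTuple k n e (g e) i) fun e => dynkinTuple_mem (g e) i,
      fun i => freeCoeff_dynkinTuple (hg 1 one_ne_zero i)⟩
  have ha (e : ℕ) : tupleComp e (tupleEquiv k n a) = dynkinTuple k n e (g e) :=
    funext fun i => tupleComp_tupleEquiv e a i
  refine ⟨tupleEquiv k n a, tupleComp_ext fun e => ?_⟩
  rcases eq_or_ne e 0 with rfl | he
  · rw [tupleComp_zero_left, tupleComp_zero_left]
  · rw [tupleComp_d, ha, lieD_dynkinTuple, hgd e he, dynkinTuple_dertCoeff he]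

/-! ### The second cohomology -/

theorem tupleComp_r (e : ℕ) :
    tupleComp e (r k) = if e = 1 then ![FreeLieAlgebra.of k 1, 0] else 0 := by
  funext i
  rw [r, tupleComp_tupleEquiv]
  fin_cases i <;> by_cases h : e = 1 <;> simp [comp_X, h]

theorem tupleComp_t (e : ℕ) :
    tupleComp e (t k) = if e = 1 then ![FreeLieAlgebra.of k 1, FreeLieAlgebra.of k 0] else 0 := by
  funext i
  rw [t, tupleComp_tupleEquiv]
  fin_cases i <;> by_cases h : e = 1 <;> simp [comp_X, h]

theorem r_mem_ker : r k ∈ LinearMap.ker (d k 2) := by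
  refine mem_ker_d_iff.2 fun e => ?_
  rw [tupleComp_r]
  split_ifs
  · funext j
    fin_cases j <;>
      simp [lieD, liePull_apply, coface, lieSubst_of, Finset.sum_range_succ, Finset.sum_filter,
        Fin.sum_univ_three, pow_succ]
  · rw [map_zero]

theorem t_mem_ker : t k ∈ LinearMap.ker (d k 2) := by
  refine mem_ker_d_iff.2 fun e => ?_
  rw [tupleComp_t]
  split_ifs
  · funext j
    fin_cases j <;>
      simp [lieD, liePull_apply, coface, lieSubst_of, Finset.sum_range_succ, Finset.sum_filter,
        Fin.sum_univ_three, pow_succ]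
  · rw [map_zero]

theorem tupleComp_eq_zero_of_mem_ker {u : dert k 2} (hu : u ∈ LinearMap.ker (d k 2)) {e : ℕ}
    (he : e ≠ 1) : tupleComp e u = 0 := by
  rcases eq_or_ne e 0 with rfl | he0
  · exact tupleComp_zero_left u
  obtain ⟨g, hg⟩ := exists_wordD_one_eq (α := Fin (e + 1)) (by rw [Fintype.card_fin]; omega)
    (wordD_dertCoeff_of_mem_ker hu e)
  have hzero : dynkinTuple k 1 e g = 0 :=
    funext fun i => eq_zero_of_mem_lieHomog_one_letter (by omega) (dynkinTuple_mem g i)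
  rw [← dynkinTuple_dertCoeff he0, ← hg, ← lieD_dynkinTuple, hzero, map_zero]

theorem ker_d_two : LinearMap.ker (d k 2) = Submodule.span k {r k, t k} := by
  refine le_antisymm (fun u hu => Submodule.mem_span_pair.2 ?_) (Submodule.span_le.2 ?_)
  · refine ⟨freeCoeff k 1 (tupleComp 1 u 0) - freeCoeff k 0 (tupleComp 1 u 1),
      freeCoeff k 0 (tupleComp 1 u 1), tupleComp_ext fun e => ?_⟩
    rw [map_add, map_smul, map_smul, tupleComp_r, tupleComp_t]
    split_ifs with he
    · subst he
      funext i
      rw [lieHomog_one (tupleComp_mem 1 u i), Fin.sum_univ_two]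
      fin_cases i <;> simp [freeCoeff_tupleComp_one, sub_smul]
    · rw [tupleComp_eq_zero_of_mem_ker hu he, smul_zero, smul_zero, add_zero]
  · rintro _ (rfl | rfl)
    exacts [r_mem_ker, t_mem_ker]

theorem linearIndependent_r_t : LinearIndependent k ![r k, t k] := by
  refine LinearIndependent.pair_iff.2 fun a b h => ?_
  have hcomp := congrArg (tupleComp 1) h
  simp only [map_add, map_smul, tupleComp_r, tupleComp_t, if_true, map_zero] at hcomp
  have hb : b = 0 := by simpa [freeCoeff_of] using congrArg (freeCoeff k 0) (congrFun hcomp 1)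
  have hab : a + b = 0 := by simpa [freeCoeff_of] using congrArg (freeCoeff k 1) (congrFun hcomp 0)
  exact ⟨by rwa [hb, add_zero] at hab, hb⟩

theorem coboundaries_two : coboundaries k 2 = ⊥ :=
  LinearMap.range_eq_bot.2 <| LinearMap.ext fun v => by
    rw [Subsingleton.elim v 0, map_zero, map_zero]

theorem bijective_mkQ_coboundaries_two : Function.Bijective
    ((coboundaries k 2).submoduleOf (LinearMap.ker (d k 2))).mkQ := by
  refine ⟨?_, Submodule.mkQ_surjective _⟩
  rw [← LinearMap.ker_eq_bot, Submodule.ker_mkQ, coboundaries_two, Submodule.submoduleOf,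
    Submodule.comap_bot, Submodule.ker_subtype]

end CharZero

/-! ### The third cohomology -/

theorem lieD_three (a : FreeLieAlgebra k (Fin 3)) :
    lieD k 3 ![0, a, 0] =
      ![0, lieSubst (coface 3 2) a - lieSubst (coface 3 3) a + lieSubst (coface 3 4) a,
        lieSubst (coface 3 0) a - lieSubst (coface 3 1) a + lieSubst (coface 3 2) a, 0] := by
  funext j
  fin_cases j <;>
    simp [lieD, liePull_apply, Finset.sum_range_succ, pow_succ, coface, sub_eq_add_neg]

variable [CharZero k]

/-- The signed sum of the coefficients of a tangential derivation at the words with three distinct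
letters. It is the linear functional that detects the third cohomology. -/
def altCoeff : dert k 3 →ₗ[k] k := altSum k (Fin 3) ∘ₗ dertCoeff 2

theorem altCoeff_d (v : dert k 2) : altCoeff (d k 2 v) = 0 := by
  rw [altCoeff, LinearMap.comp_apply, dertCoeff_d, altSum_wordD]

theorem mem_coboundaries_of_altCoeff_eq_zero {u : dert k 3} (hu : u ∈ LinearMap.ker (d k 3))
    (h : altCoeff u = 0) : u ∈ coboundaries k 3 := by
  refine mem_range_d_of_dertCoeff fun e _ => ?_
  rcases eq_or_ne e 2 with rfl | he
  · exact exists_wordD_two_eq_of_altSum_eq_zero (wordD_dertCoeff_of_mem_ker hu 2)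
      (dertCoeff_const 2 u) h
  · exact exists_wordD_two_eq (by rw [Fintype.card_fin]; omega) (wordD_dertCoeff_of_mem_ker hu e)
      (dertCoeff_const e u)

theorem tupleComp_zxElt (e : ℕ) : tupleComp e (zxElt k) =
    if e = 2 then ![0, ⁅FreeLieAlgebra.of k (2 : Fin 3), FreeLieAlgebra.of k (0 : Fin 3)⁆, 0]
    else 0 := by
  have hcomp : ⁅X k (2 : Fin 3), X k (0 : Fin 3)⁆.comp e =
      if e = 2 then ⁅FreeLieAlgebra.of k (2 : Fin 3), FreeLieAlgebra.of k (0 : Fin 3)⁆ else 0 := by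
    rcases e with _ | e
    · exact comp_zero_right _
    · rw [comp_X_lie, comp_X]
      by_cases he : e = 1 <;> simp [he]
  funext i
  rw [zxElt, tupleComp_tupleEquiv]
  fin_cases i
  · by_cases he : e = 2 <;> simp [he]
  · refine hcomp.trans ?_
    by_cases he : e = 2 <;> simp [he]
  · by_cases he : e = 2 <;> simp [he]

theorem zxElt_mem_ker : zxElt k ∈ LinearMap.ker (d k 3) := by
  refine mem_ker_d_iff.2 fun e => ?_
  rw [tupleComp_zxElt]
  split_ifs
  · have hsubst (i : ℕ) (l : Fin 3) (s : Finset (Fin 4))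
        (hs : Finset.univ.filter (fun j => coface 3 i j = some l) = s) :
        lieSubst (coface 3 i) (FreeLieAlgebra.of k l) = ∑ j ∈ s, FreeLieAlgebra.of k j := by
      rw [lieSubst_of, hs]
    rw [lieD_three]
    simp only [LieHom.map_lie, hsubst 0 0 {1} (by decide), hsubst 0 2 {3} (by decide),
      hsubst 1 0 {0, 1} (by decide), hsubst 1 2 {3} (by decide), hsubst 2 0 {0} (by decide),
      hsubst 2 2 {3} (by decide), hsubst 3 0 {0} (by decide), hsubst 3 2 {2, 3} (by decide),
      hsubst 4 0 {0} (by decide), hsubst 4 2 {2} (by decide), Finset.sum_singleton,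
      Finset.sum_pair (show (0 : Fin 4) ≠ 1 by decide),
      Finset.sum_pair (show (2 : Fin 4) ≠ 3 by decide), add_lie, lie_add]
    funext j
    fin_cases j <;> simp [-lie_skew]
  · rw [map_zero]

section ZxElt

attribute [local instance 100] LieRing.ofAssociativeRing

theorem altCoeff_zxElt : altCoeff (zxElt k) = 2 := by
  have htoAssoc : toAssoc k 3 ⁅FreeLieAlgebra.of k (2 : Fin 3), FreeLieAlgebra.of k (0 : Fin 3)⁆ =
      wordProd k ![2, 0] - wordProd k ![0, 2] := by
    simp [toAssoc, LieRing.of_associative_ring_bracket, wordProd]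
  have hval (i : Fin 3) (w : Fin 2 → Fin 3) : dertCoeff 2 (zxElt k) (Fin.cons i w) =
      if i = 1 then (if ![2, 0] = w then 1 else 0) - if ![0, 2] = w then 1 else 0 else 0 := by
    rw [dertCoeff, LinearMap.comp_apply, tupleComp_zxElt, if_pos rfl]
    refine (congrFun (tupleCoeff_cons _ i) w).trans ?_
    fin_cases i
    · simp
    · simp [htoAssoc, wordCoeff_wordProd]
    · simp
  have hchain (S : Fin 2 → Finset (Fin 3)) := hval (chainWord S 0) (Fin.tail (chainWord S))
  simp only [Fin.cons_self_tail] at hchain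
  rw [altCoeff, LinearMap.comp_apply, altSum_fin_three]
  norm_num +decide [hchain]

end ZxElt

theorem mk_zxElt_ne_zero :
    (Submodule.Quotient.mk ⟨zxElt k, zxElt_mem_ker⟩ : cohomology k 3) ≠ 0 := by
  intro h
  have hmem := (Submodule.Quotient.mk_eq_zero _).1 h
  obtain ⟨v, hv⟩ : zxElt k ∈ coboundaries k 3 := hmem
  have halt : altCoeff (zxElt k) = 0 := hv ▸ altCoeff_d v
  exact two_ne_zero (altCoeff_zxElt.symm.trans halt)

theorem span_singleton_mkQ_eq_top {K M : Type*} [Field K] [AddCommGroup M] [Module K M]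
    {B : Submodule K M} {ℓ : M →ₗ[K] K} (hB : LinearMap.ker ℓ ≤ B) {z : M} (hz : ℓ z ≠ 0) :
    Submodule.span K {B.mkQ z} = ⊤ := by
  rw [← Set.image_singleton, ← Submodule.map_span, Submodule.map_mkQ_eq_top, sup_comm]
  exact top_unique <|
    (LinearMap.span_singleton_sup_ker_eq_top ℓ hz).ge.trans (sup_le_sup_left hB _)

theorem span_mk_zxElt_eq_top :
    Submodule.span k {(Submodule.Quotient.mk ⟨zxElt k, zxElt_mem_ker⟩ : cohomology k 3)} = ⊤ :=
  span_singleton_mkQ_eq_top (ℓ := altCoeff ∘ₗ (LinearMap.ker (d k 3)).subtype)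
    (fun u hu => mem_coboundaries_of_altCoeff_eq_zero u.2 hu)
    (altCoeff_zxElt.trans_ne two_ne_zero)

end Cohomology

end

end TangentialDer

theorem mainTheorem6 (k : Type*) [Field k] [CharZero k] :
    (Function.Bijective ((TangentialDer.coboundaries k 2).submoduleOf
        (LinearMap.ker (TangentialDer.d k 2))).mkQ ∧
      LinearMap.ker (TangentialDer.d k 2) =
        Submodule.span k {TangentialDer.r k, TangentialDer.t k} ∧
      LinearIndependent k ![TangentialDer.r k, TangentialDer.t k]) ∧
    (Module.finrank k (TangentialDer.cohomology k 3) = 1 ∧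
      ∃ h : TangentialDer.zxElt k ∈ LinearMap.ker (TangentialDer.d k 3),
        (Submodule.Quotient.mk ⟨TangentialDer.zxElt k, h⟩ : TangentialDer.cohomology k 3) ≠ 0 ∧
        Submodule.span k
          {(Submodule.Quotient.mk ⟨TangentialDer.zxElt k, h⟩ : TangentialDer.cohomology k 3)} =
            ⊤) := by
  have hspan := TangentialDer.span_mk_zxElt_eq_top (k := k)
  have hne := TangentialDer.mk_zxElt_ne_zero (k := k)
  exact ⟨⟨TangentialDer.bijective_mkQ_coboundaries_two, TangentialDer.ker_d_two,
    TangentialDer.linearIndependent_r_t⟩, (finrank_eq_one_iff_of_nonzero _ hne).2 hspan,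
    TangentialDer.zxElt_mem_ker, hne, hspan⟩
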